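/- Let $T>0$, $a>0$, and assume the following. $(H_\Phi)$ $\Phi\in C[-a,a]\cap C^1(-a,a)$, and $\phi=\Phi':(-a,a)\to\mathbb R$ is an increasing homeomorphism (onto $\mathbb R$) with $\phi(0)=0$. $(H_f)$ $f:[0,T]\times\mathbb R\to\mathbb R$ is continuous and, with $F(t,\tau)=\int_0^\tau f(t,s)\,ds$, there is $\alpha\in\mathbb R$ such that $\lim_{|s|\to\infty}f(t,s)=0$ and $\lim_{|s|\to\infty}F(t,s)=\alpha$, both uniformly in $t\in[0,T]$. $(H_h)$ $h:[0,T]\to\mathbb R$ is continuous and $\int_0^T h(t)\,dt=0$. Let $X=W^{1,\infty}_\#(0,T)$ be the Sobolev space of $T$-periodic functions $u$ that are bounded together with their distributional derivative $u'$, with norm $\|u\|_X=\|u\|_\infty+\|u'\|_\infty$. Put $K=\{v\in X:\|v'\|_\infty\le a\}$ and $W=\{v\in X:\int_0^T v\,dt=0\}$, and define on $X$ $$J(v)=\begin{cases}\int_0^T[\Phi(v')+h(t)v]\,dt,&v\in K,\\+\infty,&v\notin K,\end{cases}\qquad \mathcal F(v)=\int_0^T F(t,v)\,dt,\qquad I=J+\mathcal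 F.$$ A critical point of $I$ (in Szulkin's sense) is a $u\in K$ such that $\mathcal F$ is differentiable at $u$ and $J(v)-J(u)+\langle\mathcal F'(u),v-u\rangle\ge 0$ for all $v\in X$. For $c\in\mathbb R$, $(PS)_c$ is the following condition: every sequence $(u_n)$ in $X$ for which there are $\varepsilon_n\to0$ with $I(u_n)=c+\varepsilon_n$ and $J(v)-J(u_n)+\langle\mathcal F'(u_n),v-u_n\rangle\ge-\varepsilon_n\|v-u_n\|_X$ for all $v\in X$ and all $n$ has a subsequence that converges uniformly on $[0,T]$. Then $I$ has at least one critical point. Moreover: 1. The minima $m=\min_W J$ and $\beta=\min_W I$ exist and are finite. 2. $(PS)_c$ holds for every real $c\ne m+\alpha T$. 3. If $\beta\le m+\alpha T$, then $I$ has a critical point that is a global minimizer of $I$ on $X$. 4. If $\beta>m+\alpha T$, then $I$ has a critical point $u$ of mountain-pass type: there are $u_1,u_2\in X$ with $\int_0^Tu_1\,dt<0<\int_0^Tu_2\,dt$ and $I(u_i)<\inf_W I$ for $i=1,2$, such that $I(u)=\inf_\gamma\sup_{x\in[0,1]}I(\gamma(x))$, where $\gamma$ runs over the continuous paths $[0,1]\to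 X$ with $\gamma(0)=u_1$ and $\gamma(1)=u_2$. -/

import Mathlib

open MeasureTheory Set Filter Topology
open scoped ContDiff

noncomputable section

namespace StrongResonance

/-- Lebesgue measure on the open interval `(0, T)`. -/
abbrev leb (T : ℝ) : Measure ℝ := volume.restrict (Ioo 0 T)

/-- Pairs `(u, g)` in `L^∞(0,T) × L^∞(0,T)` with the norm `‖u‖_∞ + ‖g‖_∞`. -/
abbrev LinftyPair (T : ℝ) : Type := WithLp 1 (Lp ℝ ⊤ (leb T) × Lp ℝ ⊤ (leb T))

/-- `g` is the distributional derivative of `u` in the `T`-periodic sense: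
integration by parts holds against all smooth `T`-periodic test functions. -/
def IsPeriodicWeakDeriv (T : ℝ) (u g : Lp ℝ ⊤ (leb T)) : Prop :=
  ∀ φ : ℝ → ℝ, ContDiff ℝ ∞ φ → Function.Periodic φ T →
    ∫ t, u t * deriv φ t ∂(leb T) = -∫ t, g t * φ t ∂(leb T)

lemma integrable_mul_cont {T : ℝ} (u : Lp ℝ ⊤ (leb T)) {ψ : ℝ → ℝ} (hψ : Continuous ψ) :
    Integrable (fun t => u t * ψ t) (leb T) := by
  have h1 : Integrable ψ (leb T) :=
    (hψ.integrableOn_Icc (a := 0) (b := T)).mono_set Ioo_subset_Icc_self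
  have h2 : MemLp u ⊤ (leb T) := Lp.memLp u
  exact h1.mul_of_top_right h2

/-- The Sobolev space `W^{1,∞}_#(0,T)` of `T`-periodic functions: pairs `(u, u')` of elements of
`L^∞(0,T)` such that `u'` is the periodic distributional derivative of `u` (and is therefore
determined by `u`), with the norm `‖u‖_∞ + ‖u'‖_∞` inherited from `LinftyPair T`. -/
def periodicSobolev (T : ℝ) : Submodule ℝ (LinftyPair T) where
  carrier := {p | IsPeriodicWeakDeriv T p.fst p.snd}
  zero_mem' := by
    intro φ _ _
    have h0 := Lp.coeFn_zero ℝ ⊤ (leb T)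
    have e1 : ∫ t, (0 : Lp ℝ ⊤ (leb T)) t * deriv φ t ∂(leb T) = 0 := by
      rw [← integral_zero ℝ ℝ (μ := leb T)]
      exact integral_congr_ae (by filter_upwards [h0] with t ht; rw [ht]; simp)
    have e2 : ∫ t, (0 : Lp ℝ ⊤ (leb T)) t * φ t ∂(leb T) = 0 := by
      rw [← integral_zero ℝ ℝ (μ := leb T)]
      exact integral_congr_ae (by filter_upwards [h0] with t ht; rw [ht]; simp)
    change ∫ t, (0 : Lp ℝ ⊤ (leb T)) t * deriv φ t ∂(leb T)
      = -∫ t, (0 : Lp ℝ ⊤ (leb T)) t * φ t ∂(leb T)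
    rw [e1, e2, neg_zero]
  add_mem' := by
    intro p q hp hq φ hφ hper
    have hc : Continuous φ := hφ.continuous
    have hd : Continuous (deriv φ) := hφ.continuous_deriv (by simp)
    have key : ∀ (x y : Lp ℝ ⊤ (leb T)) (ψ : ℝ → ℝ), Continuous ψ →
        ∫ t, (x + y : Lp ℝ ⊤ (leb T)) t * ψ t ∂(leb T)
          = ∫ t, x t * ψ t ∂(leb T) + ∫ t, y t * ψ t ∂(leb T) := by
      intro x y ψ hψ
      rw [← integral_add (integrable_mul_cont x hψ) (integrable_mul_cont y hψ)]
      refine integral_congr_ae ?_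
      filter_upwards [Lp.coeFn_add x y] with t ht
      rw [ht, Pi.add_apply, add_mul]
    change ∫ t, (p.fst + q.fst : Lp ℝ ⊤ (leb T)) t * deriv φ t ∂(leb T)
      = -∫ t, (p.snd + q.snd : Lp ℝ ⊤ (leb T)) t * φ t ∂(leb T)
    rw [key _ _ _ hd, key _ _ _ hc, hp φ hφ hper, hq φ hφ hper]
    ring
  smul_mem' := by
    intro c p hp φ hφ hper
    have key : ∀ (x : Lp ℝ ⊤ (leb T)) (ψ : ℝ → ℝ),
        ∫ t, (c • x : Lp ℝ ⊤ (leb T)) t * ψ t ∂(leb T) = c * ∫ t, x t * ψ t ∂(leb T) := by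
      intro x ψ
      rw [← integral_const_mul]
      refine integral_congr_ae ?_
      filter_upwards [Lp.coeFn_smul c x] with t ht
      rw [ht, Pi.smul_apply, smul_eq_mul, mul_assoc]
    change ∫ t, (c • p.fst : Lp ℝ ⊤ (leb T)) t * deriv φ t ∂(leb T)
      = -∫ t, (c • p.snd : Lp ℝ ⊤ (leb T)) t * φ t ∂(leb T)
    rw [key, key, hp φ hφ hper]
    ring

/-- `W^{1,∞}_#(0,T)` as a normed space. -/
abbrev W1 (T : ℝ) : Type := periodicSobolev T

/-- The element of `L^∞(0,T)` underlying `v ∈ W^{1,∞}_#(0,T)`. -/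
def rep {T : ℝ} (v : W1 T) : Lp ℝ ⊤ (leb T) := (v : LinftyPair T).fst

/-- The distributional derivative `v' ∈ L^∞(0,T)` of `v ∈ W^{1,∞}_#(0,T)`. -/
def der {T : ℝ} (v : W1 T) : Lp ℝ ⊤ (leb T) := (v : LinftyPair T).snd

/-- The assumption on `Φ : [-a,a] → ℝ`: it is continuous on `[-a,a]`, `C¹` on `(-a,a)`, and
`φ = Φ'` is an increasing homeomorphism of `(-a,a)` onto `ℝ` with `φ(0) = 0`. -/
structure HypPhi (a : ℝ) (Φ : ℝ → ℝ) : Prop where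
  continuousOn : ContinuousOn Φ (Icc (-a) a)
  contDiffOn : ContDiffOn ℝ 1 Φ (Ioo (-a) a)
  deriv_homeo : ∃ φ : Ioo (-a) a ≃ₜ ℝ, StrictMono φ ∧ ∀ x : Ioo (-a) a, φ x = deriv Φ x
  deriv_zero : deriv Φ 0 = 0

/-- The primitive `F(t,τ) = ∫_0^τ f(t,s) ds`. -/
def primitive (f : ℝ → ℝ → ℝ) (t τ : ℝ) : ℝ := ∫ s in (0 : ℝ)..τ, f t s

/-- The assumption on `f : [0,T] × ℝ → ℝ`: it is continuous and, as `|s| → ∞`, `f(t,s) → 0` and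
`F(t,s) → α`, both uniformly in `t ∈ [0,T]`. -/
structure HypF (T : ℝ) (f : ℝ → ℝ → ℝ) (α : ℝ) : Prop where
  continuousOn : ContinuousOn (fun p : ℝ × ℝ => f p.1 p.2) (Icc 0 T ×ˢ univ)
  lim_f : ∀ ε > 0, ∃ R : ℝ, ∀ t ∈ Icc 0 T, ∀ s : ℝ, R ≤ |s| → |f t s| < ε
  lim_F : ∀ ε > 0, ∃ R : ℝ, ∀ t ∈ Icc 0 T, ∀ s : ℝ, R ≤ |s| → |primitive f t s - α| < ε

/-- The assumption on `h : [0,T] → ℝ`: it is continuous with zero mean. -/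
structure HypH (T : ℝ) (h : ℝ → ℝ) : Prop where
  continuousOn : ContinuousOn h (Icc 0 T)
  integral_zero : ∫ t in (0 : ℝ)..T, h t = 0

/-- `K = {v : ‖v'‖_∞ ≤ a}`. -/
def K (T a : ℝ) : Set (W1 T) := {v | ‖der v‖ ≤ a}

open Classical in
/-- `J(v) = ∫_0^T [Φ(v') + h v] dt` on `K`, and `+∞` outside `K`. -/
def J (T a : ℝ) (Φ h : ℝ → ℝ) (v : W1 T) : EReal :=
  if v ∈ K T a then ((∫ t, (Φ (der v t) + h t * rep v t) ∂(leb T) : ℝ) : EReal) else ⊤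

/-- `𝓕(v) = ∫_0^T F(t,v) dt`. -/
def calF (T : ℝ) (f : ℝ → ℝ → ℝ) (v : W1 T) : ℝ :=
  ∫ t, primitive f t (rep v t) ∂(leb T)

/-- The energy functional `I = J + 𝓕`. -/
def energy (T a : ℝ) (Φ : ℝ → ℝ) (f : ℝ → ℝ → ℝ) (h : ℝ → ℝ) (v : W1 T) : EReal :=
  J T a Φ h v + (calF T f v : EReal)

/-- Critical points in the sense of Szulkin: `u ∈ K` and
`J(v) - J(u) + ⟨𝓕'(u), v - u⟩ ≥ 0` for all `v`, with `𝓕'(u)` the Fréchet derivative. -/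
def IsCriticalPoint (T a : ℝ) (Φ : ℝ → ℝ) (f : ℝ → ℝ → ℝ) (h : ℝ → ℝ) (u : W1 T) : Prop :=
  u ∈ K T a ∧ DifferentiableAt ℝ (calF T f) u ∧
    ∀ v : W1 T, 0 ≤ J T a Φ h v - J T a Φ h u + ((fderiv ℝ (calF T f) u (v - u) : ℝ) : EReal)

/-- Palais-Smale sequences at level `c`. -/
def IsPalaisSmaleSeq (T a : ℝ) (Φ : ℝ → ℝ) (f : ℝ → ℝ → ℝ) (h : ℝ → ℝ) (c : ℝ)
    (u : ℕ → W1 T) : Prop :=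
  ∃ ε : ℕ → ℝ, Tendsto ε atTop (𝓝 0) ∧
    (∀ n, energy T a Φ f h (u n) = ((c + ε n : ℝ) : EReal)) ∧
    ∀ n, ∀ v : W1 T, ((-ε n * ‖v - u n‖ : ℝ) : EReal) ≤
      J T a Φ h v - J T a Φ h (u n) + ((fderiv ℝ (calF T f) (u n) (v - u n) : ℝ) : EReal)

/-- The Palais-Smale condition at level `c`: every Palais-Smale sequence at level `c` has a
uniformly convergent subsequence. For elements of `W^{1,∞}_#(0,T)`, identified with their
continuous representatives, uniform convergence on `[0,T]` is convergence in `L^∞(0,T)`. -/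
def PalaisSmaleCondition (T a : ℝ) (Φ : ℝ → ℝ) (f : ℝ → ℝ → ℝ) (h : ℝ → ℝ) (c : ℝ) : Prop :=
  ∀ u : ℕ → W1 T, IsPalaisSmaleSeq T a Φ f h c u →
    ∃ (k : ℕ → ℕ) (w : Lp ℝ ⊤ (leb T)), StrictMono k ∧
      Tendsto (fun n => rep (u (k n))) atTop (𝓝 w)

/-- The subspace `W` of functions with zero mean. -/
def meanZero (T : ℝ) : Set (W1 T) := {v | ∫ t, rep v t ∂(leb T) = 0}

/-- The minimax level of `I` over the continuous paths in `W^{1,∞}_#(0,T)` joining `u₁` to `u₂`. -/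
def minimaxLevel (T a : ℝ) (Φ : ℝ → ℝ) (f : ℝ → ℝ → ℝ) (h : ℝ → ℝ) (u₁ u₂ : W1 T) : EReal :=
  ⨅ γ : Path u₁ u₂, ⨆ x : unitInterval, energy T a Φ f h (γ x)

/-- `u` is a critical point of mountain-pass type with respect to `W`: there are `u₁`, `u₂` in the
two components of the complement of `W` (negative and positive mean) with `I(u_i) < inf_W I`, such
that `I(u)` is the minimax level over the paths joining `u₁` to `u₂`. -/
def IsMountainPassPoint (T a : ℝ) (Φ : ℝ → ℝ) (f : ℝ → ℝ → ℝ) (h : ℝ → ℝ) (u : W1 T) : Prop :=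
  IsCriticalPoint T a Φ f h u ∧
    ∃ u₁ u₂ : W1 T, ∫ t, rep u₁ t ∂(leb T) < 0 ∧ 0 < ∫ t, rep u₂ t ∂(leb T) ∧
      energy T a Φ f h u₁ < ⨅ v ∈ meanZero T, energy T a Φ f h v ∧
      energy T a Φ f h u₂ < ⨅ v ∈ meanZero T, energy T a Φ f h v ∧
      energy T a Φ f h u = minimaxLevel T a Φ f h u₁ u₂

end StrongResonance

end

/-!
The energy `I = J + 𝓕` is the sum of a convex functional that is finite on `K` only and of a smooth
functional whose derivative is `⟨𝓕'(u), w⟩ = ∫ f(t, u) w`. Three facts about `K` carry the proof. Its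
elements have Lipschitz representatives with the common constant `a`, so that sequences in `K` with
bounded means have uniformly convergent subsequences (`exists_subseq_tendsto`). On `K` the functional
`J` is convex, bounded, invariant under the addition of constants because `h` has zero mean, and lower
semicontinuous for uniform convergence (`action_lsc`). Finally an element of `K` differs from its
average by at most `a T`, so that `𝓕` tends to `α T` and `𝓕'` to zero as the mean tends to infinity
(`calF_at_infinity`).

The minima over the mean-zero functions exist by the direct method, and so does a global minimum if
`β ≤ m + α T`: either `β` itself is the global minimum, or the energy takes values below the level
`m + α T` at infinity and is coercive below any such value (`exists_global_min`).

A Palais-Smale sequence whose means tend to infinity is compared with the translates of a minimizer of `J`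
over the mean-zero functions that have the same means; then `J` tends to `m` along it, and its level
is `m + α T` (`AlmostCritical.exists_subseq`). At all other levels a subsequence converges
uniformly, and its limit is critical at the same level (`AlmostCritical.limit`).

If `β > m + α T`, large constants of either sign added to a minimizer of `J` have energy below `β`,
and every path between them crosses the mean-zero functions, so that the minimax level `c` is at
least `β`. It is shown to be critical by a direct deformation. For `v ∈ K` let `P v` minimize
`w ↦ J(w) + ⟨𝓕'(v), w⟩ + ‖w - v‖²/2` over `K`, with the norm of `L²`. If no critical point has
energy `c`, the linearized energy drops from `v` to `P v` by a definite amount for all `v` with energy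
close to `c` (`exists_uniform_drop`); therefore `v ↦ v + s (P v - v)` with a small fixed `s` lowers an
almost optimal path below `c`. The deformed path is continuous for the uniform norm only, but by the
convexity of `J` the segments between nearby points of it stay below `c`, and they make up a path
that is continuous in the Sobolev norm (`exists_critical_of_minimax`).
-/

noncomputable section

namespace StrongResonance

variable {T a α c : ℝ} {Φ h : ℝ → ℝ} {f : ℝ → ℝ → ℝ}

/-! ### Essentially bounded functions on `(0, T)` -/

theorem ae_abs_le_norm {T : ℝ} (u : Lp ℝ ⊤ (leb T)) : ∀ᵐ t ∂(leb T), |u t| ≤ ‖u‖ := by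
  filter_upwards [ae_le_eLpNormEssSup (f := u) (μ := leb T)] with t ht
  rw [← eLpNorm_exponent_top, ← Lp.enorm_def, enorm_le_iff_norm_le] at ht
  exact ht

theorem norm_le_of_ae_abs_le {T : ℝ} {u : Lp ℝ ⊤ (leb T)} {C : ℝ} (hC : 0 ≤ C)
    (h : ∀ᵐ t ∂(leb T), |u t| ≤ C) : ‖u‖ ≤ C := by
  have h' : ∀ᵐ t ∂(leb T), ‖u t‖ ≤ C := h
  simpa using Lp.norm_le_of_ae_bound hC h'

theorem leb_real_univ {T : ℝ} (hT : 0 < T) : (leb T).real univ = T := by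
  simp [Measure.real, hT.le]

theorem integral_leb {T : ℝ} (hT : 0 < T) (g : ℝ → ℝ) :
    ∫ t, g t ∂(leb T) = ∫ t in (0 : ℝ)..T, g t := by
  rw [intervalIntegral.integral_of_le hT.le, integral_Ioc_eq_integral_Ioo]

theorem ae_leb_mem (T : ℝ) : ∀ᵐ t ∂(leb T), t ∈ Ioo 0 T :=
  ae_restrict_mem measurableSet_Ioo

theorem integrable_of_ae_bound {T : ℝ} {g : ℝ → ℝ} (hg : AEStronglyMeasurable g (leb T)) {C : ℝ}
    (h : ∀ᵐ t ∂(leb T), |g t| ≤ C) : Integrable g (leb T) :=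
  Integrable.of_bound hg C h

theorem abs_integral_le_of_ae {T : ℝ} (hT : 0 < T) {g : ℝ → ℝ} {C : ℝ}
    (h : ∀ᵐ t ∂(leb T), |g t| ≤ C) : |∫ t, g t ∂(leb T)| ≤ C * T := by
  have h' : ∀ᵐ t ∂(leb T), ‖g t‖ ≤ C := h
  simpa [leb_real_univ hT] using norm_integral_le_of_norm_le_const h'

theorem integrable_Lp {T : ℝ} (u : Lp ℝ ⊤ (leb T)) : Integrable u (leb T) :=
  integrable_of_ae_bound (Lp.aestronglyMeasurable u) (ae_abs_le_norm u)

/-! ### Algebra of the periodic Sobolev space -/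

theorem rep_add (u v : W1 T) : rep (u + v) = rep u + rep v := rfl
theorem rep_sub (u v : W1 T) : rep (u - v) = rep u - rep v := rfl
theorem rep_smul (c : ℝ) (u : W1 T) : rep (c • u) = c • rep u := rfl
theorem der_add (u v : W1 T) : der (u + v) = der u + der v := rfl
theorem der_sub (u v : W1 T) : der (u - v) = der u - der v := rfl
theorem der_smul (c : ℝ) (u : W1 T) : der (c • u) = c • der u := rfl

theorem norm_W1 (u : W1 T) : ‖u‖ = ‖rep u‖ + ‖der u‖ :=
  WithLp.prod_norm_eq_of_L1 (u : LinftyPair T)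

theorem norm_rep_le (u : W1 T) : ‖rep u‖ ≤ ‖u‖ := by
  rw [norm_W1]; linarith [norm_nonneg (der u)]

theorem rep_add_ae (u v : W1 T) : ∀ᵐ t ∂(leb T), rep (u + v) t = rep u t + rep v t :=
  Lp.coeFn_add (rep u) (rep v)

theorem rep_sub_ae (u v : W1 T) : ∀ᵐ t ∂(leb T), rep (u - v) t = rep u t - rep v t :=
  Lp.coeFn_sub (rep u) (rep v)

theorem rep_smul_ae (c : ℝ) (u : W1 T) : ∀ᵐ t ∂(leb T), rep (c • u) t = c * rep u t :=
  Lp.coeFn_smul c (rep u)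

theorem der_add_ae (u v : W1 T) : ∀ᵐ t ∂(leb T), der (u + v) t = der u t + der v t :=
  Lp.coeFn_add (der u) (der v)

theorem der_sub_ae (u v : W1 T) : ∀ᵐ t ∂(leb T), der (u - v) t = der u t - der v t :=
  Lp.coeFn_sub (der u) (der v)

theorem der_smul_ae (c : ℝ) (u : W1 T) : ∀ᵐ t ∂(leb T), der (c • u) t = c * der u t :=
  Lp.coeFn_smul c (der u)

/-! ### Periodic test functions -/

/-- The `T`-periodic function that agrees with `χ` on `[0, T)`. -/
def periodize (T : ℝ) (χ : ℝ → ℝ) (x : ℝ) : ℝ := χ (x - ⌊x / T⌋ * T)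

theorem periodize_periodic (hT : 0 < T) (χ : ℝ → ℝ) : Function.Periodic (periodize T χ) T := by
  intro x
  have : (x + T) / T = x / T + 1 := by field_simp
  simp only [periodize, this, Int.floor_add_one]
  push_cast
  ring_nf

theorem periodize_eq (hT : 0 < T) (χ : ℝ → ℝ) {x : ℝ} (hx : x ∈ Ioo 0 T) :
    periodize T χ x = χ x := by
  have : ⌊x / T⌋ = 0 := by
    rw [Int.floor_eq_zero_iff]
    exact ⟨by have := hx.1; positivity, by rw [div_lt_one hT]; exact hx.2⟩
  simp [periodize, this]

theorem contDiff_periodize (hT : 0 < T) {χ : ℝ → ℝ} (hχ : ContDiff ℝ ∞ χ)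
    (hs : tsupport χ ⊆ Ioo 0 T) : ContDiff ℝ ∞ (periodize T χ) := by
  rw [contDiff_iff_contDiffAt]
  intro x
  set k : ℤ := ⌊x / T⌋ with hk
  have hk1 : (k : ℝ) * T ≤ x := by
    have := Int.floor_le (x / T); rwa [le_div_iff₀ hT] at this
  have hk2 : x < (k + 1) * T := by
    have := Int.lt_floor_add_one (x / T); rwa [div_lt_iff₀ hT] at this
  rcases hk1.lt_or_eq with hlt | heq
  · -- inside a period the function is a translate of `χ`
    have : periodize T χ =ᶠ[𝓝 x] fun z => χ (z - k * T) := by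
      filter_upwards [Ioo_mem_nhds hlt hk2] with z hz
      have : ⌊z / T⌋ = k := by
        rw [Int.floor_eq_iff]
        exact ⟨by rw [le_div_iff₀ hT]; exact hz.1.le, by rw [div_lt_iff₀ hT]; exact hz.2⟩
      simp [periodize, this]
    refine ContDiffAt.congr_of_eventuallyEq ?_ this
    exact (hχ.comp (contDiff_id.sub contDiff_const)).contDiffAt
  · -- at the end points of a period the function vanishes on both sides
    have h0 : ∀ᶠ z in 𝓝 (0 : ℝ), χ z = 0 :=
      notMem_tsupport_iff_eventuallyEq.1 fun h => lt_irrefl _ (hs h).1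
    have h1 : ∀ᶠ z in 𝓝 T, χ z = 0 :=
      notMem_tsupport_iff_eventuallyEq.1 fun h => lt_irrefl _ (hs h).2
    have t0 : Tendsto (fun z : ℝ => z - k * T) (𝓝 x) (𝓝 0) := by
      have : Continuous fun z : ℝ => z - k * T := by fun_prop
      simpa [heq] using this.tendsto x
    have t1 : Tendsto (fun z : ℝ => z - (k - 1) * T) (𝓝 x) (𝓝 T) := by
      have : Continuous fun z : ℝ => z - (k - 1) * T := by fun_prop
      have h := this.tendsto x
      rwa [← heq, show (k : ℝ) * T - (k - 1) * T = T by ring, heq] at h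
    have : periodize T χ =ᶠ[𝓝 x] fun _ => 0 := by
      filter_upwards [t0.eventually h0, t1.eventually h1,
        Ioo_mem_nhds (a := x - T) (b := x + T) (by linarith) (by linarith)] with z hz0 hz1 hz
      rcases le_or_gt x z with hxz | hxz
      · have : ⌊z / T⌋ = k := by
          rw [Int.floor_eq_iff]
          refine ⟨by rw [le_div_iff₀ hT]; linarith, ?_⟩
          rw [div_lt_iff₀ hT]; have := hz.2; linarith
        simp [periodize, this, hz0]
      · have : ⌊z / T⌋ = k - 1 := by
          rw [Int.floor_eq_iff]
          push_cast
          refine ⟨by rw [le_div_iff₀ hT]; have := hz.1; linarith, ?_⟩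
          rw [div_lt_iff₀ hT]; linarith
        simp [periodize, this, hz1]
    exact contDiffAt_const.congr_of_eventuallyEq this

theorem contDiff_primitive {ψ : ℝ → ℝ} (hψ : ContDiff ℝ ∞ ψ) :
    ContDiff ℝ ∞ (fun x => ∫ t in (0 : ℝ)..x, ψ t) ∧
      deriv (fun x => ∫ t in (0 : ℝ)..x, ψ t) = ψ := by
  have hd : ∀ x, HasDerivAt (fun x => ∫ t in (0 : ℝ)..x, ψ t) (ψ x) x := fun x =>
    intervalIntegral.integral_hasDerivAt_right (hψ.continuous.intervalIntegrable _ _)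
      (hψ.continuous.stronglyMeasurableAtFilter _ _) hψ.continuous.continuousAt
  have he : deriv (fun x => ∫ t in (0 : ℝ)..x, ψ t) = ψ := funext fun x => (hd x).deriv
  refine ⟨?_, he⟩
  rw [contDiff_infty_iff_deriv, he]
  exact ⟨fun x => (hd x).differentiableAt, hψ⟩

theorem periodic_primitive {ψ : ℝ → ℝ} (hψ : Continuous ψ) (hper : Function.Periodic ψ T)
    (h0 : ∫ t in (0 : ℝ)..T, ψ t = 0) :
    Function.Periodic (fun x => ∫ t in (0 : ℝ)..x, ψ t) T := by
  intro x
  have h1 := intervalIntegral.integral_add_adjacent_intervals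
    (hψ.intervalIntegrable (μ := volume) 0 x) (hψ.intervalIntegrable x (x + T))
  have h2 := hper.intervalIntegral_add_eq x 0
  simp only [zero_add] at h2
  simp only
  rw [← h1, h2, h0, add_zero]

/-- An integrable function on `(0, T)` that is orthogonal to the derivatives of all smooth
periodic functions is constant. -/
theorem ae_eq_const_of_integral_deriv_eq_zero (hT : 0 < T) {D : ℝ → ℝ}
    (hD : Integrable D (leb T))
    (h : ∀ φ : ℝ → ℝ, ContDiff ℝ ∞ φ → Function.Periodic φ T →
      ∫ t, D t * deriv φ t ∂(leb T) = 0) :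
    ∃ c : ℝ, ∀ᵐ t ∂(leb T), D t = c := by
  set c := (∫ t, D t ∂(leb T)) / T with hc
  refine ⟨c, ?_⟩
  have hloc : LocallyIntegrableOn (fun t => D t - c) (Ioo 0 T) volume :=
    IntegrableOn.locallyIntegrableOn (hD.sub (integrable_const c))
  have key := isOpen_Ioo.ae_eq_zero_of_integral_contDiff_smul_eq_zero hloc ?_
  · rw [ae_restrict_iff' measurableSet_Ioo]
    filter_upwards [key] with t ht hm
    linarith [ht hm]
  intro χ hχ hcs hs
  have hcont := hχ.continuous
  -- outside `(0, T)` the integrand vanishes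
  have hset : ∫ t, χ t • (D t - c) = ∫ t, χ t * (D t - c) ∂(leb T) := by
    refine (setIntegral_eq_integral_of_forall_compl_eq_zero fun t ht => ?_).symm
    rw [image_eq_zero_of_notMem_tsupport fun h => ht (hs h), zero_smul]
  rw [hset]
  set κ := (∫ t, χ t ∂(leb T)) / T with hκ
  have hiχ : Integrable χ (leb T) :=
    (hcont.integrableOn_Icc (a := 0) (b := T)).mono_set Ioo_subset_Icc_self
  set ψ : ℝ → ℝ := fun x => periodize T χ x - κ with hψ
  have hψs : ContDiff ℝ ∞ ψ := (contDiff_periodize hT hχ hs).sub contDiff_const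
  have hψp : Function.Periodic ψ T := fun x => by
    simp only [hψ, periodize_periodic hT χ x]
  have hψae : ∀ᵐ t ∂(leb T), ψ t = χ t - κ := by
    filter_upwards [ae_leb_mem T] with t ht
    rw [hψ]; simp only [periodize_eq hT χ ht]
  have hψ0 : ∫ t in (0 : ℝ)..T, ψ t = 0 := by
    rw [← integral_leb hT, integral_congr_ae hψae, integral_sub hiχ (integrable_const _),
      integral_const, leb_real_univ hT, hκ]
    simp; field_simp; ring
  have hφ := contDiff_primitive hψs
  have h1 := h _ hφ.1 (periodic_primitive hψs.continuous hψp hψ0)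
  rw [hφ.2] at h1
  have hDχ : Integrable (fun t => χ t * D t) (leb T) := by
    obtain ⟨C, hC⟩ := hcont.bounded_above_of_compact_support hcs
    exact hD.bdd_mul hcont.aestronglyMeasurable (.of_forall hC)
  have h2 : ∫ t, D t * ψ t ∂(leb T) = ∫ t, χ t * D t ∂(leb T) - κ * ∫ t, D t ∂(leb T) := by
    rw [← integral_const_mul, ← integral_sub hDχ (hD.const_mul κ)]
    refine integral_congr_ae ?_
    filter_upwards [hψae] with t ht
    rw [ht]; ring
  have h3 : ∫ t, χ t * (D t - c) ∂(leb T)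
      = ∫ t, χ t * D t ∂(leb T) - c * ∫ t, χ t ∂(leb T) := by
    rw [← integral_const_mul, ← integral_sub hDχ (hiχ.const_mul c)]
    refine integral_congr_ae (.of_forall fun t => ?_)
    ring
  rw [h3]
  rw [h2] at h1
  have : κ * ∫ t, D t ∂(leb T) = c * ∫ t, χ t ∂(leb T) := by
    rw [hκ, hc]; ring
  linarith

/-! ### Lipschitz representatives -/

theorem integral_der_eq_zero (v : W1 T) : ∫ t, der v t ∂(leb T) = 0 := by
  have h : IsPeriodicWeakDeriv T (rep v) (der v) := v.2
  have := h (fun _ => 1) contDiff_const (fun _ => rfl)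
  simpa using this.symm

/-- Every element of the Sobolev space is represented by a Lipschitz function whose classical
derivative represents the distributional one. -/
theorem exists_lipschitz_rep (hT : 0 < T) (v : W1 T) :
    ∃ U : ℝ → ℝ, LipschitzWith ‖der v‖₊ U ∧ U 0 = U T ∧ (∀ᵐ t ∂(leb T), rep v t = U t) ∧
      ∀ᵐ t ∂(leb T), der v t = deriv U t := by
  set g : ℝ → ℝ := indicator (Ioo 0 T) (der v) with hg
  have hgi : Integrable g volume :=
    (integrable_indicator_iff measurableSet_Ioo).2 (integrable_Lp (der v))
  have hgae : ∀ᵐ t ∂(leb T), g t = der v t := by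
    filter_upwards [ae_leb_mem T] with t ht
    simp [hg, ht]
  have hgb : ∀ᵐ t, |g t| ≤ ‖der v‖ := by
    have := ae_abs_le_norm (der v)
    rw [ae_restrict_iff' measurableSet_Ioo] at this
    filter_upwards [this] with t ht
    by_cases hm : t ∈ Ioo 0 T
    · simpa [hg, hm] using ht hm
    · simp [hg, hm]
  set U : ℝ → ℝ := fun x => ∫ t in (0 : ℝ)..x, g t with hU
  have hlip : LipschitzWith ‖der v‖₊ U := by
    refine LipschitzWith.of_dist_le_mul fun x y => ?_
    rw [Real.dist_eq, Real.dist_eq, coe_nnnorm, hU]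
    simp only
    rw [intervalIntegral.integral_interval_sub_left hgi.intervalIntegrable hgi.intervalIntegrable]
    have : ∀ᵐ t, t ∈ uIoc y x → ‖g t‖ ≤ ‖der v‖ := by
      filter_upwards [hgb] with t ht _ using ht
    exact intervalIntegral.norm_integral_le_of_norm_le_const_ae this
  have hder : ∀ᵐ t ∂(leb T), deriv U t = der v t := by
    filter_upwards [hgae, 
      ae_restrict_of_ae (LocallyIntegrable.ae_hasDerivAt_integral hgi.locallyIntegrable)]
      with t h1 h2
    rw [(h2 0).deriv, h1]
  have hUT : U T = 0 := by
    rw [hU]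
    simp only
    rw [← integral_leb hT, integral_congr_ae hgae, integral_der_eq_zero]
  have hU0 : U 0 = 0 := by simp [hU]
  have hUi : Integrable U (leb T) :=
    (hlip.continuous.integrableOn_Icc (a := 0) (b := T)).mono_set Ioo_subset_Icc_self
  obtain ⟨c, hc⟩ := ae_eq_const_of_integral_deriv_eq_zero hT
    ((integrable_Lp (rep v)).sub hUi) (fun φ hφ hp => by
      have h1 : IsPeriodicWeakDeriv T (rep v) (der v) := v.2
      have h2 := h1 φ hφ hp
      have hφ' : Continuous (deriv φ) := hφ.continuous_deriv (by simp)
      have h3 := (hlip.lipschitzOnWith (s := uIcc 0 T)).absolutelyContinuousOnInterval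
        |>.integral_mul_deriv_eq_deriv_mul
        ((hφ.of_le (by simp)).contDiffOn.absolutelyContinuousOnInterval : _)
      have hUφ : Integrable (fun t => U t * deriv φ t) (leb T) :=
        ((hlip.continuous.mul hφ').integrableOn_Icc (a := 0) (b := T)).mono_set
          Ioo_subset_Icc_self
      rw [hUT, hU0, ← integral_leb hT, ← integral_leb hT] at h3
      have h4 : ∫ t, deriv U t * φ t ∂(leb T) = ∫ t, der v t * φ t ∂(leb T) := by
        refine integral_congr_ae ?_
        filter_upwards [hder] with t ht
        rw [ht]
      have h5 : ∫ t, (⇑(rep v) - U) t * deriv φ t ∂(leb T)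
          = ∫ t, rep v t * deriv φ t ∂(leb T) - ∫ t, U t * deriv φ t ∂(leb T) := by
        rw [← integral_sub (integrable_mul_cont _ hφ') hUφ]
        refine integral_congr_ae (.of_forall fun t => ?_)
        simp [sub_mul]
      rw [h5, h2, h3, h4]
      ring)
  refine ⟨fun t => U t + c, ?_, ?_, ?_, ?_⟩
  · simpa using hlip.add (LipschitzWith.const c)
  · simp [hUT, hU0]
  · filter_upwards [hc] with t ht
    simp only [Pi.sub_apply] at ht
    linarith
  · filter_upwards [hder] with t ht
    rw [deriv_add_const, ht]

/-- A Lipschitz function with equal values at `0` and `T` defines an element of the Sobolev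
space. -/
theorem exists_of_lipschitz (hT : 0 < T) {C : NNReal} {U : ℝ → ℝ} (hU : LipschitzWith C U)
    (h0 : U 0 = U T) :
    ∃ v : W1 T, (∀ᵐ t ∂(leb T), rep v t = U t) ∧ ‖der v‖ ≤ C := by
  obtain ⟨B, hB⟩ := isCompact_Icc.exists_bound_of_continuousOn
    (hU.continuous.continuousOn (s := Icc 0 T))
  have hm1 : MemLp U ⊤ (leb T) := by
    refine memLp_top_of_bound hU.continuous.aestronglyMeasurable B ?_
    filter_upwards [ae_leb_mem T] with t ht using hB t (Ioo_subset_Icc_self ht)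
  have hm2 : MemLp (deriv U) ⊤ (leb T) :=
    memLp_top_of_bound (measurable_deriv U).aestronglyMeasurable C
      (.of_forall fun t => norm_deriv_le_of_lipschitz hU)
  have e1 := hm1.coeFn_toLp
  have e2 := hm2.coeFn_toLp
  have hw : IsPeriodicWeakDeriv T (hm1.toLp U) (hm2.toLp (deriv U)) := by
    intro φ hφ hp
    have h3 := (hU.lipschitzOnWith (s := uIcc 0 T)).absolutelyContinuousOnInterval
      |>.integral_mul_deriv_eq_deriv_mul
      ((hφ.of_le (by simp)).contDiffOn.absolutelyContinuousOnInterval : _)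
    have hφT : φ T = φ 0 := by simpa using hp 0
    rw [← integral_leb hT, ← integral_leb hT, hφT, h0, sub_self, zero_sub] at h3
    have h4 : ∫ t, hm1.toLp U t * deriv φ t ∂(leb T) = ∫ t, U t * deriv φ t ∂(leb T) := by
      refine integral_congr_ae ?_
      filter_upwards [e1] with t ht
      rw [ht]
    have h5 : ∫ t, hm2.toLp (deriv U) t * φ t ∂(leb T) = ∫ t, deriv U t * φ t ∂(leb T) := by
      refine integral_congr_ae ?_
      filter_upwards [e2] with t ht
      rw [ht]
    rw [h4, h5, h3]
  refine ⟨⟨WithLp.toLp 1 (hm1.toLp U, hm2.toLp (deriv U)), hw⟩, e1, ?_⟩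
  refine norm_le_of_ae_abs_le C.2 ?_
  filter_upwards [e2] with t ht
  change |hm2.toLp (deriv U) t| ≤ C
  rw [ht]
  exact norm_deriv_le_of_lipschitz hU

/-- A continuous representative is bounded on all of `[0, T]` by the essential supremum. -/
theorem abs_le_norm_of_ae_eq (hT : 0 < T) {v : Lp ℝ ⊤ (leb T)} {U : ℝ → ℝ} (hU : Continuous U)
    (h : ∀ᵐ t ∂(leb T), v t = U t) : ∀ t ∈ Icc 0 T, |U t| ≤ ‖v‖ := by
  have h1 : (fun t => max |U t| ‖v‖) =ᵐ[volume.restrict (Ioo 0 T)] fun _ => ‖v‖ := by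
    filter_upwards [h, ae_abs_le_norm v] with t h2 h3
    rw [← h2]
    exact max_eq_right h3
  have hc : Continuous fun t => max |U t| ‖v‖ := by fun_prop
  have h2 := Measure.eqOn_Ioo_of_ae_eq _ h1 hc.continuousOn continuousOn_const
  have h3 := h2.closure hc continuous_const
  rw [closure_Ioo hT.ne] at h3
  intro t ht
  exact (le_max_left _ _).trans_eq (h3 ht)

/-! ### The constant functions and the mean -/

theorem exists_const_one (hT : 0 < T) :
    ∃ e : W1 T, (∀ᵐ t ∂(leb T), rep e t = 1) ∧ der e = 0 := by
  obtain ⟨v, h1, h2⟩ := exists_of_lipschitz hT (LipschitzWith.const (1 : ℝ)) rfl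
  exact ⟨v, h1, norm_le_zero_iff.1 h2⟩

/-- The integral `∫_0^T v`. -/
def mean (v : W1 T) : ℝ := ∫ t, rep v t ∂(leb T)

theorem mean_add (u v : W1 T) : mean (u + v) = mean u + mean v := by
  rw [mean, integral_congr_ae (rep_add_ae u v), integral_add (integrable_Lp _) (integrable_Lp _)]
  rfl

theorem mean_sub (u v : W1 T) : mean (u - v) = mean u - mean v := by
  rw [mean, integral_congr_ae (rep_sub_ae u v), integral_sub (integrable_Lp _) (integrable_Lp _)]
  rfl

theorem mean_smul (c : ℝ) (u : W1 T) : mean (c • u) = c * mean u := by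
  rw [mean, integral_congr_ae (rep_smul_ae c u), integral_const_mul]
  rfl

theorem mean_of_ae_one (hT : 0 < T) {e : W1 T} (he : ∀ᵐ t ∂(leb T), rep e t = 1) :
    mean e = T := by
  rw [mean, integral_congr_ae he]
  simp [leb_real_univ hT]

theorem abs_mean_le (hT : 0 < T) (v : W1 T) : |mean v| ≤ ‖rep v‖ * T :=
  abs_integral_le_of_ae hT (ae_abs_le_norm (rep v))

/-- The oscillation of `v` about its average is controlled by `v'`. -/
theorem ae_abs_sub_mean_le (hT : 0 < T) (v : W1 T) :
    ∀ᵐ t ∂(leb T), |rep v t - mean v / T| ≤ ‖der v‖ * T := by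
  obtain ⟨U, hU, -, hae, -⟩ := exists_lipschitz_rep hT v
  have hUi : Integrable U (leb T) :=
    (hU.continuous.integrableOn_Icc (a := 0) (b := T)).mono_set Ioo_subset_Icc_self
  have hm : mean v = ∫ t, U t ∂(leb T) := integral_congr_ae hae
  filter_upwards [hae, ae_leb_mem T] with t ht htm
  have h1 : ∫ s, (U t - U s) ∂(leb T) = T * U t - mean v := by
    rw [integral_sub (integrable_const _) hUi, integral_const, leb_real_univ hT, hm]
    simp
  have h2 : |∫ s, (U t - U s) ∂(leb T)| ≤ ‖der v‖ * T * T := by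
    refine abs_integral_le_of_ae hT ?_
    filter_upwards [ae_leb_mem T] with s hs
    have := hU.dist_le_mul t s
    rw [Real.dist_eq, Real.dist_eq, coe_nnnorm] at this
    refine this.trans (mul_le_mul_of_nonneg_left ?_ (norm_nonneg _))
    rw [abs_le]
    constructor <;> linarith [hs.1, hs.2, htm.1, htm.2]
  rw [h1] at h2
  rw [ht, show U t - mean v / T = (T * U t - mean v) / T by field_simp, abs_div, abs_of_pos hT,
    div_le_iff₀ hT]
  exact h2

theorem norm_rep_le_mean (hT : 0 < T) (v : W1 T) :
    ‖rep v‖ ≤ |mean v| / T + ‖der v‖ * T := by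
  refine norm_le_of_ae_abs_le (by positivity) ?_
  filter_upwards [ae_abs_sub_mean_le hT v] with t ht
  have h1 : |rep v t| ≤ |rep v t - mean v / T| + |mean v / T| := by
    have := abs_add_le (rep v t - mean v / T) (mean v / T)
    simpa using this
  rw [abs_div, abs_of_pos hT] at h1
  linarith

/-! ### Compactness -/

/-- Uniformly bounded, uniformly Lipschitz sequences have uniformly convergent subsequences, with
a limit that satisfies the same Lipschitz bound. -/
theorem exists_subseq_tendsto (hT : 0 < T) {a R : ℝ} (ha : 0 ≤ a) {u : ℕ → W1 T}
    (hu : ∀ n, u n ∈ K T a) (hR : ∀ n, ‖rep (u n)‖ ≤ R) :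
    ∃ (k : ℕ → ℕ) (w : W1 T), StrictMono k ∧ w ∈ K T a ∧
      Tendsto (fun n => rep (u (k n))) atTop (𝓝 (rep w)) := by
  choose U hlip hper hae _ using fun n => exists_lipschitz_rep hT (u n)
  have hlip' : ∀ n, LipschitzWith a.toNNReal (U n) := fun n =>
    (hlip n).weaken (by
      rw [← NNReal.coe_le_coe, Real.coe_toNNReal a ha]; exact hu n)
  let V : ℕ → BoundedContinuousFunction (Icc 0 T) ℝ := fun n =>
    BoundedContinuousFunction.mkOfCompact ⟨fun t => U n t, (hlip' n).continuous.comp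
      continuous_subtype_val⟩
  have hV : ∀ n (t : Icc (0 : ℝ) T), V n t = U n t := fun n t => rfl
  have hcomp : IsCompact (closure (range V)) := by
    refine BoundedContinuousFunction.arzela_ascoli (Icc (-R) R) isCompact_Icc _ ?_ ?_
    · rintro _ t ⟨n, rfl⟩
      exact abs_le.1 ((abs_le_norm_of_ae_eq hT (hlip n).continuous (hae n) t t.2).trans (hR n))
    · refine (LipschitzWith.uniformEquicontinuous _ a.toNNReal ?_).equicontinuous
      rintro ⟨_, n, rfl⟩
      exact (hlip' n).comp (LipschitzWith.subtype_val _) |>.weaken (by simp)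
  obtain ⟨G, -, k, hk, hG⟩ := hcomp.tendsto_subseq (x := V)
    (fun n => subset_closure (mem_range_self n))
  have hGp : ∀ t : Icc (0 : ℝ) T, Tendsto (fun n => V (k n) t) atTop (𝓝 (G t)) := fun t =>
    ((BoundedContinuousFunction.lipschitz_eval_const t).continuous.tendsto G).comp hG
  have hGl : LipschitzWith a.toNNReal (IccExtend hT.le G) := by
    refine LipschitzWith.of_dist_le_mul fun x y => ?_
    have h1 : dist (G (projIcc 0 T hT.le x)) (G (projIcc 0 T hT.le y))
        ≤ a.toNNReal * dist (projIcc 0 T hT.le x) (projIcc 0 T hT.le y) :=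
      le_of_tendsto ((hGp _).dist (hGp _)) (.of_forall fun n => (hlip' (k n)).dist_le_mul _ _)
    refine h1.trans (mul_le_mul_of_nonneg_left ?_ NNReal.zero_le_coe)
    simpa using (LipschitzWith.projIcc hT.le).dist_le_mul x y
  have hGe : ∀ t (ht : t ∈ Icc 0 T), IccExtend hT.le G t = G ⟨t, ht⟩ := fun t ht =>
    IccExtend_of_mem _ _ ht
  have hG0 : IccExtend hT.le G 0 = IccExtend hT.le G T := by
    rw [hGe 0 (left_mem_Icc.2 hT.le), hGe T (right_mem_Icc.2 hT.le)]
    refine tendsto_nhds_unique (hGp _) ((hGp ⟨T, right_mem_Icc.2 hT.le⟩).congr fun n => ?_)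
    rw [hV, hV]
    exact (hper (k n)).symm
  obtain ⟨w, hw1, hw2⟩ := exists_of_lipschitz hT hGl hG0
  refine ⟨k, w, hk, by simpa [K, ha] using hw2, ?_⟩
  rw [tendsto_iff_norm_sub_tendsto_zero]
  refine squeeze_zero (fun _ => norm_nonneg _) (fun n => ?_)
    (tendsto_iff_norm_sub_tendsto_zero.1 hG)
  refine norm_le_of_ae_abs_le (norm_nonneg _) ?_
  filter_upwards [rep_sub_ae (u (k n)) w, hae (k n), hw1, ae_leb_mem T] with t h1 h2 h3 ht
  rw [rep_sub] at h1
  rw [h1, h2, h3, hGe t (Ioo_subset_Icc_self ht)]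
  exact (V (k n) - G).norm_coe_le_norm ⟨t, Ioo_subset_Icc_self ht⟩

/-! ### Weak convergence of derivatives -/

/-- If `v` is uniformly small and `v'` is bounded, then `v'` is weakly small. -/
theorem exists_weak_small (hT : 0 < T) {k : ℝ → ℝ} (hk : Integrable k (leb T)) {L ε : ℝ}
    (hL : 0 ≤ L) (hε : 0 < ε) :
    ∃ δ > 0, ∀ v : W1 T, ‖der v‖ ≤ L → ‖rep v‖ ≤ δ → |∫ t, k t * der v t ∂(leb T)| ≤ ε := by
  obtain ⟨χ, -, hχ, hχε⟩ := MemLp.exist_eLpNorm_sub_le (p := 1) (by simp) le_rfl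
    (memLp_one_iff_integrable.2 hk) (ε := ε / (2 * (L + 1))) (by positivity)
  have hχ' : Continuous (deriv χ) := hχ.continuous_deriv (by simp)
  obtain ⟨B, hB⟩ := isCompact_Icc.exists_bound_of_continuousOn (hχ'.continuousOn (s := Icc 0 T))
  have hB0 : 0 ≤ B := (norm_nonneg _).trans (hB 0 (left_mem_Icc.2 hT.le))
  have hχi : Integrable χ (leb T) :=
    (hχ.continuous.integrableOn_Icc (a := 0) (b := T)).mono_set Ioo_subset_Icc_self
  have hχε' : ∫ t, |k t - χ t| ∂(leb T) ≤ ε / (2 * (L + 1)) := by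
    have h1 := integral_norm_eq_lintegral_enorm (hk.sub hχi).aestronglyMeasurable
    rw [eLpNorm_one_eq_lintegral_enorm] at hχε
    have h2 := ENNReal.toReal_le_of_le_ofReal (by positivity) hχε
    rw [← h1] at h2
    exact h2
  set D := |χ T - χ 0| + B * T with hD
  refine ⟨ε / (2 * (D + 1)), by positivity, fun v hv1 hv2 => ?_⟩
  have hD0 : 0 ≤ D := by positivity
  obtain ⟨U, hU, hper, hae, hder⟩ := exists_lipschitz_rep hT v
  have hUb := abs_le_norm_of_ae_eq hT hU.continuous hae
  have hdm := Lp.aestronglyMeasurable (der v)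
  have hdb := ae_abs_le_norm (der v)
  have i1 : Integrable (fun t => (k t - χ t) * der v t) (leb T) :=
    (hk.sub hχi).mul_bdd (c := ‖der v‖) hdm hdb
  have i2 : Integrable (fun t => χ t * der v t) (leb T) := hχi.mul_bdd (c := ‖der v‖) hdm hdb
  have hsplit : ∫ t, k t * der v t ∂(leb T)
      = ∫ t, (k t - χ t) * der v t ∂(leb T) + ∫ t, χ t * der v t ∂(leb T) := by
    rw [← integral_add i1 i2]
    refine integral_congr_ae (.of_forall fun t => ?_)
    ring
  have h1 : |∫ t, (k t - χ t) * der v t ∂(leb T)| ≤ ε / 2 := by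
    calc |∫ t, (k t - χ t) * der v t ∂(leb T)|
        ≤ ∫ t, |(k t - χ t) * der v t| ∂(leb T) := abs_integral_le_integral_abs
      _ ≤ ∫ t, |k t - χ t| * L ∂(leb T) := by
          refine integral_mono_ae i1.abs ((hk.sub hχi).abs.mul_const L) ?_
          filter_upwards [hdb] with t ht
          simp only [abs_mul]
          exact mul_le_mul_of_nonneg_left (ht.trans hv1) (abs_nonneg _)
      _ = (∫ t, |k t - χ t| ∂(leb T)) * L := integral_mul_const _ _
      _ ≤ ε / (2 * (L + 1)) * (L + 1) := by
          apply mul_le_mul hχε' (by linarith) hL (by positivity)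
      _ = ε / 2 := by field_simp
  have h2 : ∫ t, χ t * der v t ∂(leb T)
      = (χ T - χ 0) * U 0 - ∫ t, deriv χ t * U t ∂(leb T) := by
    have h3 := ((hχ.of_le (by simp)).contDiffOn.absolutelyContinuousOnInterval
        : AbsolutelyContinuousOnInterval χ 0 T).integral_mul_deriv_eq_deriv_mul
      (hU.lipschitzOnWith (s := uIcc 0 T)).absolutelyContinuousOnInterval
    rw [← integral_leb hT, ← integral_leb hT, ← hper] at h3
    rw [sub_mul, ← h3]
    refine integral_congr_ae ?_
    filter_upwards [hder] with t ht
    rw [ht]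
  have h3 : |∫ t, deriv χ t * U t ∂(leb T)| ≤ B * ‖rep v‖ * T := by
    refine abs_integral_le_of_ae hT ?_
    filter_upwards [ae_leb_mem T] with t ht
    rw [abs_mul]
    have ht' := Ioo_subset_Icc_self ht
    exact mul_le_mul (hB t ht') (hUb t ht') (abs_nonneg _) hB0
  have h4 : |(χ T - χ 0) * U 0| ≤ |χ T - χ 0| * ‖rep v‖ := by
    rw [abs_mul]
    exact mul_le_mul_of_nonneg_left (hUb 0 (left_mem_Icc.2 hT.le)) (abs_nonneg _)
  have h5 : |∫ t, χ t * der v t ∂(leb T)| ≤ ε / 2 := by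
    rw [h2]
    calc |(χ T - χ 0) * U 0 - ∫ t, deriv χ t * U t ∂(leb T)|
        ≤ |(χ T - χ 0) * U 0| + |∫ t, deriv χ t * U t ∂(leb T)| := abs_sub _ _
      _ ≤ D * ‖rep v‖ := by rw [hD]; linarith
      _ ≤ (D + 1) * (ε / (2 * (D + 1))) :=
          mul_le_mul (by linarith) hv2 (norm_nonneg _) (by linarith)
      _ = ε / 2 := by field_simp
  rw [hsplit]
  exact (abs_add_le _ _).trans (by linarith)

/-! ### The convex integrand -/

namespace HypPhi

theorem deriv_mono (hΦ : HypPhi a Φ) : MonotoneOn (deriv Φ) (Ioo (-a) a) := by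
  obtain ⟨φ, hφ, he⟩ := hΦ.deriv_homeo
  intro x hx y hy hxy
  rw [← he ⟨x, hx⟩, ← he ⟨y, hy⟩]
  exact hφ.monotone hxy

theorem hasDerivAt (hΦ : HypPhi a Φ) {x : ℝ} (hx : x ∈ Ioo (-a) a) :
    HasDerivAt Φ (deriv Φ x) x :=
  ((hΦ.contDiffOn.differentiableOn (by simp)).differentiableAt
    (isOpen_Ioo.mem_nhds hx)).hasDerivAt

theorem convexOn (hΦ : HypPhi a Φ) : ConvexOn ℝ (Icc (-a) a) Φ := by
  refine MonotoneOn.convexOn_of_deriv (convex_Icc _ _) hΦ.continuousOn ?_ ?_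
  · rw [interior_Icc]
    exact fun x hx => (hΦ.hasDerivAt hx).differentiableAt.differentiableWithinAt
  · rw [interior_Icc]
    exact hΦ.deriv_mono

theorem tangent_le (hΦ : HypPhi a Φ) {x y : ℝ} (hx : x ∈ Ioo (-a) a) (hy : y ∈ Icc (-a) a) :
    Φ x + deriv Φ x * (y - x) ≤ Φ y := by
  have hx' := Ioo_subset_Icc_self hx
  rcases lt_trichotomy x y with hxy | rfl | hxy
  · have := hΦ.convexOn.le_slope_of_hasDerivAt hx' hy hxy (hΦ.hasDerivAt hx)
    rw [slope_def_field, le_div_iff₀ (by linarith)] at this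
    linarith
  · simp
  · have := hΦ.convexOn.slope_le_of_hasDerivAt hy hx' hxy (hΦ.hasDerivAt hx)
    rw [slope_def_field, div_le_iff₀ (by linarith)] at this
    linarith

theorem exists_bound (hΦ : HypPhi a Φ) : ∃ B, ∀ x ∈ Icc (-a) a, |Φ x| ≤ B :=
  isCompact_Icc.exists_bound_of_continuousOn hΦ.continuousOn

theorem aesm_comp (hΦ : HypPhi a Φ) (ha : 0 < a) {g : ℝ → ℝ}
    (hg : AEStronglyMeasurable g (leb T)) (hga : ∀ᵐ t ∂(leb T), |g t| ≤ a) :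
    AEStronglyMeasurable (fun t => Φ (g t)) (leb T) := by
  have hle : -a ≤ a := by linarith
  have hc : Continuous (IccExtend hle ((Icc (-a) a).domRestrict Φ)) :=
    (continuousOn_iff_continuous_domRestrict.1 hΦ.continuousOn).Icc_extend'
  refine (hc.comp_aestronglyMeasurable hg).congr ?_
  filter_upwards [hga] with t ht
  rw [IccExtend_of_mem _ _ (abs_le.1 ht)]
  rfl

end HypPhi

/-! ### The convex part of the energy -/

theorem mem_K_ae {v : W1 T} (hv : v ∈ K T a) : ∀ᵐ t ∂(leb T), |der v t| ≤ a := by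
  filter_upwards [ae_abs_le_norm (der v)] with t ht
  exact ht.trans hv

theorem segment_mem_K {v w : W1 T} (hv : v ∈ K T a) (hw : w ∈ K T a) {s : ℝ}
    (hs : s ∈ Icc (0 : ℝ) 1) : v + s • (w - v) ∈ K T a := by
  have : der (v + s • (w - v)) = (1 - s) • der v + s • der w := by
    rw [der_add, der_smul, der_sub]
    module
  simp only [K, mem_ofPred_eq, this]
  refine (norm_add_le _ _).trans ?_
  rw [norm_smul, norm_smul, Real.norm_of_nonneg hs.1, Real.norm_of_nonneg (by linarith [hs.2])]
  have h1 : ‖der v‖ ≤ a := hv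
  have h2 : ‖der w‖ ≤ a := hw
  nlinarith [hs.1, hs.2]

theorem norm_der_sub_le {v w : W1 T} (hv : v ∈ K T a) (hw : w ∈ K T a) :
    ‖der (v - w)‖ ≤ 2 * a := by
  rw [der_sub]
  have h1 : ‖der v‖ ≤ a := hv
  have h2 : ‖der w‖ ≤ a := hw
  linarith [norm_sub_le (der v) (der w)]

/-- The finite value `∫_0^T [Φ(v') + h v]` of `J` on `K`. -/
def action (Φ h : ℝ → ℝ) (v : W1 T) : ℝ := ∫ t, (Φ (der v t) + h t * rep v t) ∂(leb T)

theorem integrable_Phi (hΦ : HypPhi a Φ) (ha : 0 < a) {v : W1 T} (hv : v ∈ K T a) :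
    Integrable (fun t => Φ (der v t)) (leb T) := by
  obtain ⟨B, hB⟩ := hΦ.exists_bound
  refine integrable_of_ae_bound
    (hΦ.aesm_comp ha (Lp.aestronglyMeasurable (der v)) (mem_K_ae hv)) (C := B) ?_
  filter_upwards [mem_K_ae hv] with t ht using hB _ (abs_le.1 ht)

namespace HypH

theorem integrable (hh : HypH T h) : Integrable h (leb T) :=
  hh.continuousOn.integrableOn_Icc.mono_set Ioo_subset_Icc_self

theorem integrable_mul (hh : HypH T h) (v : W1 T) :
    Integrable (fun t => h t * rep v t) (leb T) :=
  hh.integrable.mul_bdd (c := ‖rep v‖) (Lp.aestronglyMeasurable _) (ae_abs_le_norm (rep v))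

theorem integral_leb_eq_zero (hh : HypH T h) (hT : 0 < T) : ∫ t, h t ∂(leb T) = 0 := by
  rw [integral_leb hT, hh.integral_zero]

theorem exists_bound (hh : HypH T h) (hT : 0 < T) :
    ∃ B, 0 ≤ B ∧ ∀ᵐ t ∂(leb T), |h t| ≤ B := by
  obtain ⟨B, hB⟩ := isCompact_Icc.exists_bound_of_continuousOn hh.continuousOn
  refine ⟨B, (norm_nonneg _).trans (hB 0 (left_mem_Icc.2 hT.le)), ?_⟩
  filter_upwards [ae_leb_mem T] with t ht using hB t (Ioo_subset_Icc_self ht)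

end HypH

theorem action_eq (hΦ : HypPhi a Φ) (hh : HypH T h) (ha : 0 < a) {v : W1 T} (hv : v ∈ K T a) :
    action Φ h v = ∫ t, Φ (der v t) ∂(leb T) + ∫ t, h t * rep v t ∂(leb T) :=
  integral_add (integrable_Phi hΦ ha hv) (hh.integrable_mul v)

/-- Since `h` has zero mean, `J` is bounded on `K` although `K` is unbounded. -/
theorem exists_action_bound (hT : 0 < T) (ha : 0 < a) (hΦ : HypPhi a Φ) (hh : HypH T h) :
    ∃ C, 0 ≤ C ∧ ∀ v ∈ K T a, |action Φ h v| ≤ C := by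
  obtain ⟨B, hB⟩ := hΦ.exists_bound
  obtain ⟨H, hH0, hH⟩ := hh.exists_bound hT
  have hB0 : 0 ≤ B := (abs_nonneg _).trans (hB 0 (by constructor <;> linarith))
  refine ⟨B * T + H * (a * T) * T, by positivity, fun v hv => ?_⟩
  rw [action_eq hΦ hh ha hv]
  have h1 : |∫ t, Φ (der v t) ∂(leb T)| ≤ B * T := by
    refine abs_integral_le_of_ae hT ?_
    filter_upwards [mem_K_ae hv] with t ht using hB _ (abs_le.1 ht)
  have h2 : ∫ t, h t * rep v t ∂(leb T) = ∫ t, h t * (rep v t - mean v / T) ∂(leb T) := by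
    have : ∫ t, h t * (rep v t - mean v / T) ∂(leb T)
        = ∫ t, h t * rep v t ∂(leb T) - (∫ t, h t ∂(leb T)) * (mean v / T) := by
      rw [← integral_mul_const, ← integral_sub (hh.integrable_mul v) (hh.integrable.mul_const _)]
      simp only [mul_sub]
    rw [this, hh.integral_leb_eq_zero hT]
    simp
  have h3 : |∫ t, h t * rep v t ∂(leb T)| ≤ H * (a * T) * T := by
    rw [h2]
    refine abs_integral_le_of_ae hT ?_
    filter_upwards [hH, ae_abs_sub_mean_le hT v] with t ht1 ht2
    rw [abs_mul]
    exact mul_le_mul ht1 (ht2.trans (mul_le_mul_of_nonneg_right hv hT.le)) (abs_nonneg _) hH0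
  exact (abs_add_le _ _).trans (add_le_add h1 h3)

theorem action_add_const (hT : 0 < T) (hΦ : HypPhi a Φ) (hh : HypH T h) (ha : 0 < a)
    {e v : W1 T} (he : ∀ᵐ t ∂(leb T), rep e t = 1) (hde : der e = 0) (hv : v ∈ K T a) (c : ℝ) :
    v + c • e ∈ K T a ∧ action Φ h (v + c • e) = action Φ h v := by
  have hd : der (v + c • e) = der v := by rw [der_add, der_smul, hde]; simp
  have hm : v + c • e ∈ K T a := by
    change ‖der (v + c • e)‖ ≤ a
    rw [hd]; exact hv
  refine ⟨hm, ?_⟩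
  rw [action_eq hΦ hh ha hm, action_eq hΦ hh ha hv, hd]
  have : ∫ t, h t * rep (v + c • e) t ∂(leb T)
      = ∫ t, h t * rep v t ∂(leb T) + (∫ t, h t ∂(leb T)) * c := by
    rw [← integral_mul_const, ← integral_add (hh.integrable_mul v) (hh.integrable.mul_const _)]
    refine integral_congr_ae ?_
    filter_upwards [he, rep_add_ae v (c • e), rep_smul_ae c e] with t h1 h2 h3
    rw [h2, h3, h1]; ring
  rw [this, hh.integral_leb_eq_zero hT]
  simp

/-- As `J` is invariant under the addition of constants, its minimum over the mean-zero functions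
is its minimum over the whole space. -/
theorem action_min_le (hT : 0 < T) (ha : 0 < a) (hΦ : HypPhi a Φ) (hh : HypH T h) {w₀ : W1 T}
    (hmin : ∀ v ∈ K T a, mean v = 0 → action Φ h w₀ ≤ action Φ h v) {v : W1 T}
    (hv : v ∈ K T a) : action Φ h w₀ ≤ action Φ h v := by
  obtain ⟨e, he, hde⟩ := exists_const_one hT
  have h2 := action_add_const hT hΦ hh ha he hde hv (-(mean v / T))
  rw [← h2.2]
  refine hmin _ h2.1 ?_
  rw [mean_add, mean_smul, mean_of_ae_one hT he]
  field_simp; ring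

theorem action_segment_le (hΦ : HypPhi a Φ) (hh : HypH T h) (ha : 0 < a) {v w : W1 T}
    (hv : v ∈ K T a) (hw : w ∈ K T a) {s : ℝ} (hs : s ∈ Icc (0 : ℝ) 1) :
    action Φ h (v + s • (w - v)) ≤ action Φ h v + s * (action Φ h w - action Φ h v) := by
  have hm := segment_mem_K hv hw hs
  have i : ∀ {z : W1 T}, z ∈ K T a →
      Integrable (fun t => Φ (der z t) + h t * rep z t) (leb T) := fun hz =>
    (integrable_Phi hΦ ha hz).add (hh.integrable_mul _)
  have : action Φ h v + s * (action Φ h w - action Φ h v)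
      = ∫ t, ((1 - s) * (Φ (der v t) + h t * rep v t)
        + s * (Φ (der w t) + h t * rep w t)) ∂(leb T) := by
    rw [integral_add ((i hv).const_mul _) ((i hw).const_mul _), integral_const_mul,
      integral_const_mul]
    simp only [action]
    ring
  rw [this]
  refine integral_mono_ae (i hm) (((i hv).const_mul _).add ((i hw).const_mul _)) ?_
  filter_upwards [rep_add_ae v (s • (w - v)), rep_smul_ae s (w - v), rep_sub_ae w v,
    der_add_ae v (s • (w - v)), der_smul_ae s (w - v), der_sub_ae w v, mem_K_ae hv, mem_K_ae hw]
    with t h1 h2 h3 h4 h5 h6 h7 h8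
  rw [h1, h2, h3, h4, h5, h6]
  have := hΦ.convexOn.2 (abs_le.1 h7) (abs_le.1 h8) (by linarith [hs.2] : 0 ≤ 1 - s) hs.1 (by ring)
  simp only [smul_eq_mul] at this
  rw [show der v t + s * (der w t - der v t) = (1 - s) * der v t + s * der w t by ring]
  linarith

/-- Lower semicontinuity of `J` on `K` for uniform convergence. The derivative of `Φ` is unbounded
near `±a`, so that the tangent inequality is used at `r u'` with `r < 1`. -/
theorem action_lsc (hT : 0 < T) (ha : 0 < a) (hΦ : HypPhi a Φ) (hh : HypH T h) {u : W1 T}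
    (hu : u ∈ K T a) {ε : ℝ} (hε : 0 < ε) :
    ∃ δ > 0, ∀ w ∈ K T a, ‖rep (w - u)‖ ≤ δ → action Φ h u ≤ action Φ h w + ε := by
  have huc := isCompact_Icc.uniformContinuousOn_of_continuous hΦ.continuousOn
  obtain ⟨η, hη, hηΦ⟩ := Metric.uniformContinuousOn_iff_le.1 huc (ε / (3 * T)) (by positivity)
  obtain ⟨r, hr0, hr1, hrη⟩ : ∃ r : ℝ, 0 < r ∧ r < 1 ∧ (1 - r) * a ≤ η := by
    refine ⟨1 - min (1 / 2) (η / a), ?_, ?_, ?_⟩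
    · linarith [min_le_left (1 / 2 : ℝ) (η / a)]
    · have : 0 < min (1 / 2 : ℝ) (η / a) := by positivity
      linarith
    · have := min_le_right (1 / 2 : ℝ) (η / a)
      rw [le_div_iff₀ ha] at this
      linarith
  have hrx : ∀ x ∈ Icc (-a) a, r * x ∈ Icc (-(r * a)) (r * a) := fun x hx =>
    ⟨by nlinarith [hx.1], by nlinarith [hx.2]⟩
  have hra : r * a < a := by nlinarith
  have hra0 : 0 < r * a := by positivity
  have hsub : Icc (-(r * a)) (r * a) ⊆ Ioo (-a) a := fun x hx =>
    ⟨by linarith [hx.1], by linarith [hx.2]⟩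
  set k : ℝ → ℝ := fun t => deriv Φ (r * der u t) with hk
  have hkm : AEStronglyMeasurable k (leb T) :=
    ((measurable_deriv Φ).comp_aemeasurable
      ((Lp.aestronglyMeasurable (der u)).aemeasurable.const_mul r)).aestronglyMeasurable
  have hkb : ∀ᵐ t ∂(leb T), |k t| ≤ max |deriv Φ (r * a)| |deriv Φ (-(r * a))| := by
    filter_upwards [mem_K_ae hu] with t ht
    have h1 := hrx _ (abs_le.1 ht)
    have h2 := hΦ.deriv_mono (hsub h1) (hsub (right_mem_Icc.2 (by linarith))) h1.2
    have h3 := hΦ.deriv_mono (hsub (left_mem_Icc.2 (by linarith))) (hsub h1) h1.1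
    exact (abs_le_max_abs_abs h3 h2).trans_eq (max_comm _ _)
  have hki := integrable_of_ae_bound hkm hkb
  obtain ⟨δ₁, hδ₁, hw⟩ := exists_weak_small hT hki (L := 2 * a) (ε := ε / 3) (by positivity)
    (by positivity)
  obtain ⟨H, hH0, hH⟩ := hh.exists_bound hT
  refine ⟨min δ₁ (ε / (3 * (H * T + 1))), by positivity, fun w hwK hwδ => ?_⟩
  have hmul : ∀ z : W1 T, Integrable (fun t => k t * der z t) (leb T) := fun z =>
    hki.mul_bdd (c := ‖der z‖) (Lp.aestronglyMeasurable _) (ae_abs_le_norm (der z))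
  have h1 := abs_le.1 (hw (w - u) (norm_der_sub_le hwK hu) (hwδ.trans (min_le_left _ _)))
  have h2 : ∫ t, (Φ (der u t) - ε / (3 * T) + k t * der (w - u) t) ∂(leb T)
      ≤ ∫ t, Φ (der w t) ∂(leb T) := by
    refine integral_mono_ae (((integrable_Phi hΦ ha hu).sub (integrable_const _)).add (hmul _))
      (integrable_Phi hΦ ha hwK) ?_
    filter_upwards [der_sub_ae w u, mem_K_ae hu, mem_K_ae hwK] with t h3 h4 h5
    have hx := abs_le.1 h4
    have hx' := hsub (hrx _ hx)
    have h6 := hΦ.tangent_le hx' (abs_le.1 h5)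
    have h7 : |Φ (r * der u t) - Φ (der u t)| ≤ ε / (3 * T) := by
      refine hηΦ _ (Ioo_subset_Icc_self hx') _ hx ?_
      rw [Real.dist_eq, show r * der u t - der u t = -((1 - r) * der u t) by ring, abs_neg,
        abs_mul, abs_of_pos (by linarith : 0 < 1 - r)]
      exact (mul_le_mul_of_nonneg_left h4 (by linarith)).trans hrη
    have h8 : 0 ≤ k t * der u t := by
      have h0 : (0 : ℝ) ∈ Ioo (-a) a := ⟨by linarith, ha⟩
      rcases le_total 0 (der u t) with hd | hd
      · have := hΦ.deriv_mono h0 hx' (by positivity)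
        rw [hΦ.deriv_zero] at this
        exact mul_nonneg this hd
      · have := hΦ.deriv_mono hx' h0 (by nlinarith)
        rw [hΦ.deriv_zero] at this
        exact mul_nonneg_of_nonpos_of_nonpos this hd
    have h9 := (abs_le.1 h7).1
    have h10 : k t * (der w t - r * der u t)
        = k t * (der w t - der u t) + (1 - r) * (k t * der u t) := by ring
    have h11 : 0 ≤ (1 - r) * (k t * der u t) := mul_nonneg (by linarith) h8
    simp only [h3]
    change Φ (r * der u t) + k t * (der w t - r * der u t) ≤ _ at h6
    linarith
  have h3 : ∫ t, (Φ (der u t) - ε / (3 * T) + k t * der (w - u) t) ∂(leb T)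
      = ∫ t, Φ (der u t) ∂(leb T) - ε / 3 + ∫ t, k t * der (w - u) t ∂(leb T) := by
    have i0 : Integrable (fun t => Φ (der u t) - ε / (3 * T)) (leb T) :=
      (integrable_Phi hΦ ha hu).sub (integrable_const _)
    rw [integral_add i0 (hmul _), integral_sub (integrable_Phi hΦ ha hu) (integrable_const _), integral_const,
      leb_real_univ hT, smul_eq_mul]
    congr 2
    field_simp
  have h4 : |∫ t, h t * rep (w - u) t ∂(leb T)| ≤ ε / 3 := by
    have h5 : |∫ t, h t * rep (w - u) t ∂(leb T)| ≤ H * ‖rep (w - u)‖ * T := by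
      refine abs_integral_le_of_ae hT ?_
      filter_upwards [hH, ae_abs_le_norm (rep (w - u))] with t h6 h7
      rw [abs_mul]
      exact mul_le_mul h6 h7 (abs_nonneg _) hH0
    have h6 := hwδ.trans (min_le_right _ _)
    rw [le_div_iff₀ (by positivity)] at h6
    nlinarith [norm_nonneg (rep (w - u))]
  have h5 : ∫ t, h t * rep (w - u) t ∂(leb T)
      = ∫ t, h t * rep w t ∂(leb T) - ∫ t, h t * rep u t ∂(leb T) := by
    rw [← integral_sub (hh.integrable_mul w) (hh.integrable_mul u)]
    refine integral_congr_ae ?_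
    filter_upwards [rep_sub_ae w u] with t ht
    rw [ht]; ring
  rw [action_eq hΦ hh ha hu, action_eq hΦ hh ha hwK]
  linarith [(abs_le.1 h4).1]

/-! ### The nonlinearity -/

namespace HypF

theorem exists_bound (hf : HypF T f α) :
    ∃ M, 0 ≤ M ∧ ∀ t ∈ Icc 0 T, ∀ s, |f t s| ≤ M := by
  obtain ⟨R, hR⟩ := hf.lim_f 1 one_pos
  obtain ⟨B, hB⟩ := (isCompact_Icc.prod (isCompact_Icc (a := -R) (b := R))).exists_bound_of_continuousOn
    (hf.continuousOn.mono (prod_mono_right (subset_univ _)))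
  refine ⟨max B 1, by positivity, fun t ht s => ?_⟩
  rcases le_total R |s| with h | h
  · exact (hR t ht s h).le.trans (le_max_right _ _)
  · exact (hB (t, s) ⟨ht, abs_le.1 h⟩).trans (le_max_left _ _)

/-- Continuity and the limit at infinity make `f` uniformly continuous in the second variable. -/
theorem uniform_continuity (hf : HypF T f α) {ε : ℝ} (hε : 0 < ε) :
    ∃ δ > 0, ∀ t ∈ Icc 0 T, ∀ s s', |s - s'| ≤ δ → |f t s - f t s'| ≤ ε := by
  obtain ⟨R, hR⟩ := hf.lim_f (ε / 2) (by positivity)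
  have huc := (isCompact_Icc.prod
    (isCompact_Icc (a := -(R + 1)) (b := R + 1))).uniformContinuousOn_of_continuous
    (hf.continuousOn.mono (prod_mono_right (subset_univ _)))
  obtain ⟨δ, hδ, hδf⟩ := Metric.uniformContinuousOn_iff_le.1 huc ε hε
  refine ⟨min δ 1, by positivity, fun t ht s s' hs => ?_⟩
  have hs1 := hs.trans (min_le_right _ _)
  have far : R ≤ |s| → R ≤ |s'| → |f t s - f t s'| ≤ ε := fun h1 h2 => by
    have h3 := hR t ht s h1
    have h4 := hR t ht s' h2
    linarith [abs_sub (f t s) (f t s')]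
  have hd1 : |s| ≤ |s'| + |s - s'| := by
    have := abs_sub_abs_le_abs_sub s s'; linarith
  have hd2 : |s'| ≤ |s| + |s - s'| := by
    have := abs_sub_abs_le_abs_sub s' s; rw [abs_sub_comm s' s] at this; linarith
  by_cases h1 : |s| ≤ R + 1
  · by_cases h2 : |s'| ≤ R + 1
    · refine hδf (t, s) ⟨ht, abs_le.1 h1⟩ (t, s') ⟨ht, abs_le.1 h2⟩ ?_
      rw [Prod.dist_eq]
      simp only [dist_self, Real.dist_eq]
      exact max_le hδ.le (hs.trans (min_le_left _ _))
    · exact far (by linarith) (by linarith)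
  · exact far (by linarith) (by linarith)

theorem continuous_extension (hf : HypF T f α) (hT : 0 < T) :
    Continuous fun p : ℝ × ℝ => f (projIcc 0 T hT.le p.1) p.2 := by
  refine hf.continuousOn.comp_continuous
    (f := fun p : ℝ × ℝ => ((projIcc 0 T hT.le p.1 : ℝ), p.2)) ?_ ?_
  · exact (continuous_subtype_val.comp (continuous_projIcc.comp continuous_fst)).prodMk
      continuous_snd
  · exact fun p => ⟨(projIcc 0 T hT.le p.1).2, mem_univ _⟩

theorem continuous_snd (hf : HypF T f α) {t : ℝ} (ht : t ∈ Icc 0 T) : Continuous (f t) :=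
  hf.continuousOn.comp_continuous (f := fun s => (t, s)) (by fun_prop) fun _ => ⟨ht, mem_univ _⟩

theorem aesm_comp (hf : HypF T f α) (hT : 0 < T) {g : ℝ → ℝ}
    (hg : AEStronglyMeasurable g (leb T)) :
    AEStronglyMeasurable (fun t => f t (g t)) (leb T) := by
  refine ((hf.continuous_extension hT).comp_aestronglyMeasurable
    (aestronglyMeasurable_id.prodMk hg)).congr ?_
  filter_upwards [ae_leb_mem T] with t ht
  simp only [id]
  rw [projIcc_of_mem hT.le (Ioo_subset_Icc_self ht)]

theorem aesm_primitive_comp (hf : HypF T f α) (hT : 0 < T) {g : ℝ → ℝ}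
    (hg : AEStronglyMeasurable g (leb T)) :
    AEStronglyMeasurable (fun t => primitive f t (g t)) (leb T) := by
  have hc : Continuous fun p : ℝ × ℝ => ∫ s in (0 : ℝ)..p.2, f (projIcc 0 T hT.le p.1) s := by
    refine intervalIntegral.continuous_parametric_intervalIntegral_of_continuous
      (f := fun (p : ℝ × ℝ) s => f (projIcc 0 T hT.le p.1) s) ?_ _root_.continuous_snd
    exact (hf.continuous_extension hT).comp (g := fun p : ℝ × ℝ => f (projIcc 0 T hT.le p.1) p.2)
      (f := fun q : (ℝ × ℝ) × ℝ => (q.1.1, q.2)) (by fun_prop)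
  refine (hc.comp_aestronglyMeasurable (aestronglyMeasurable_id.prodMk hg)).congr ?_
  filter_upwards [ae_leb_mem T] with t ht
  simp only [id, primitive]
  rw [projIcc_of_mem hT.le (Ioo_subset_Icc_self ht)]

theorem primitive_sub (hf : HypF T f α) {t : ℝ} (ht : t ∈ Icc 0 T) (x y : ℝ) :
    primitive f t y - primitive f t x = ∫ s in x..y, f t s :=
  intervalIntegral.integral_interval_sub_left
    ((hf.continuous_snd ht).intervalIntegrable _ _) ((hf.continuous_snd ht).intervalIntegrable _ _)

theorem abs_primitive_sub_le (hf : HypF T f α) {t : ℝ} (ht : t ∈ Icc 0 T) {M : ℝ}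
    (hM : ∀ s, |f t s| ≤ M) (x y : ℝ) :
    |primitive f t y - primitive f t x| ≤ M * |y - x| := by
  rw [hf.primitive_sub ht]
  exact intervalIntegral.norm_integral_le_of_norm_le_const (f := f t) fun s _ => hM s

theorem abs_primitive_expansion_le (hf : HypF T f α) {t : ℝ} (ht : t ∈ Icc 0 T) {x y η : ℝ}
    (hη : ∀ s, |s - x| ≤ |y - x| → |f t s - f t x| ≤ η) :
    |primitive f t y - primitive f t x - f t x * (y - x)| ≤ η * |y - x| := by
  have h1 : primitive f t y - primitive f t x - f t x * (y - x)
      = ∫ s in x..y, (f t s - f t x) := by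
    rw [hf.primitive_sub ht, intervalIntegral.integral_sub
      ((hf.continuous_snd ht).intervalIntegrable _ _) intervalIntegrable_const]
    simp [mul_comm]
  rw [h1]
  refine intervalIntegral.norm_integral_le_of_norm_le_const
    (f := fun s => f t s - f t x) fun s hs => hη s ?_
  have := uIoc_subset_uIcc hs
  exact abs_sub_left_of_mem_uIcc this

theorem integrable_comp (hf : HypF T f α) (hT : 0 < T) (u : W1 T) :
    Integrable (fun t => f t (rep u t)) (leb T) := by
  obtain ⟨M, -, hM⟩ := hf.exists_bound
  refine integrable_of_ae_bound (hf.aesm_comp hT (Lp.aestronglyMeasurable _)) (C := M) ?_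
  filter_upwards [ae_leb_mem T] with t ht using hM t (Ioo_subset_Icc_self ht) _

theorem integrable_primitive (hf : HypF T f α) (hT : 0 < T) (u : W1 T) :
    Integrable (fun t => primitive f t (rep u t)) (leb T) := by
  obtain ⟨M, hM0, hM⟩ := hf.exists_bound
  refine integrable_of_ae_bound (hf.aesm_primitive_comp hT (Lp.aestronglyMeasurable _))
    (C := M * ‖rep u‖) ?_
  filter_upwards [ae_leb_mem T, ae_abs_le_norm (rep u)] with t ht h1
  have h2 := hf.abs_primitive_sub_le (Ioo_subset_Icc_self ht) (hM t (Ioo_subset_Icc_self ht))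
    0 (rep u t)
  have h0 : primitive f t 0 = 0 := by simp [primitive]
  rw [h0, sub_zero, sub_zero] at h2
  exact h2.trans (mul_le_mul_of_nonneg_left h1 hM0)

end HypF

/-! ### The smooth part of the energy -/

/-- The candidate `⟨𝓕'(u), w⟩ = ∫_0^T f(t, u) w` for the derivative of `𝓕`. -/
def dF (f : ℝ → ℝ → ℝ) (u w : W1 T) : ℝ := ∫ t, f t (rep u t) * rep w t ∂(leb T)

theorem integrable_dF (hf : HypF T f α) (hT : 0 < T) (u w : W1 T) :
    Integrable (fun t => f t (rep u t) * rep w t) (leb T) :=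
  (hf.integrable_comp hT u).mul_bdd (c := ‖rep w‖) (Lp.aestronglyMeasurable _)
    (ae_abs_le_norm (rep w))

theorem dF_add (hf : HypF T f α) (hT : 0 < T) (u v w : W1 T) :
    dF f u (v + w) = dF f u v + dF f u w := by
  simp only [dF]
  rw [← integral_add (integrable_dF hf hT u v) (integrable_dF hf hT u w)]
  refine integral_congr_ae ?_
  filter_upwards [rep_add_ae v w] with t ht
  rw [ht]; ring

theorem dF_smul (u w : W1 T) (c : ℝ) : dF f u (c • w) = c * dF f u w := by
  simp only [dF]
  rw [← integral_const_mul]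
  refine integral_congr_ae ?_
  filter_upwards [rep_smul_ae c w] with t ht
  rw [ht]; ring

theorem dF_sub (hf : HypF T f α) (hT : 0 < T) (u v w : W1 T) :
    dF f u (v - w) = dF f u v - dF f u w := by
  have h1 := dF_add hf hT u (v - w) w
  rw [sub_add_cancel] at h1
  linarith

theorem exists_dF_bound (hf : HypF T f α) (hT : 0 < T) :
    ∃ M, 0 ≤ M ∧ ∀ u w : W1 T, |dF f u w| ≤ M * ‖rep w‖ := by
  obtain ⟨M, hM0, hM⟩ := hf.exists_bound
  refine ⟨M * T, by positivity, fun u w => ?_⟩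
  have : |dF f u w| ≤ M * ‖rep w‖ * T := by
    refine abs_integral_le_of_ae hT ?_
    filter_upwards [ae_leb_mem T, ae_abs_le_norm (rep w)] with t ht h1
    rw [abs_mul]
    exact mul_le_mul (hM t (Ioo_subset_Icc_self ht) _) h1 (abs_nonneg _) hM0
  linarith

theorem dF_continuity (hf : HypF T f α) (hT : 0 < T) {ε : ℝ} (hε : 0 < ε) :
    ∃ δ > 0, ∀ u v : W1 T, ‖rep (u - v)‖ ≤ δ → ∀ w, |dF f u w - dF f v w| ≤ ε * ‖rep w‖ := by
  obtain ⟨δ, hδ, hd⟩ := hf.uniform_continuity (ε := ε / T) (by positivity)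
  refine ⟨δ, hδ, fun u v huv w => ?_⟩
  have h1 : dF f u w - dF f v w
      = ∫ t, (f t (rep u t) * rep w t - f t (rep v t) * rep w t) ∂(leb T) :=
    (integral_sub (integrable_dF hf hT u w) (integrable_dF hf hT v w)).symm
  have h2 : |dF f u w - dF f v w| ≤ ε / T * ‖rep w‖ * T := by
    rw [h1]
    refine abs_integral_le_of_ae hT ?_
    filter_upwards [ae_leb_mem T, ae_abs_le_norm (rep w), ae_abs_le_norm (rep (u - v)),
      rep_sub_ae u v] with t ht h2 h3 h4
    rw [← sub_mul, abs_mul]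
    rw [h4] at h3
    exact mul_le_mul (hd t (Ioo_subset_Icc_self ht) _ _ (h3.trans huv)) h2 (abs_nonneg _)
      (by positivity)
  refine h2.trans_eq ?_
  field_simp

/-- The first order expansion of `𝓕`, uniform in the base point. -/
theorem calF_expansion (hf : HypF T f α) (hT : 0 < T) {ε : ℝ} (hε : 0 < ε) :
    ∃ δ > 0, ∀ u v : W1 T, ‖rep (v - u)‖ ≤ δ →
      |calF T f v - calF T f u - dF f u (v - u)| ≤ ε * ‖rep (v - u)‖ := by
  obtain ⟨δ, hδ, hd⟩ := hf.uniform_continuity (ε := ε / T) (by positivity)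
  refine ⟨δ, hδ, fun u v huv => ?_⟩
  have h1 : calF T f v - calF T f u - dF f u (v - u) = ∫ t, (primitive f t (rep v t)
      - primitive f t (rep u t) - f t (rep u t) * rep (v - u) t) ∂(leb T) := by
    have i : Integrable (fun t => primitive f t (rep v t) - primitive f t (rep u t)) (leb T) :=
      (hf.integrable_primitive hT v).sub (hf.integrable_primitive hT u)
    rw [integral_sub i (integrable_dF hf hT u _),
      integral_sub (hf.integrable_primitive hT v) (hf.integrable_primitive hT u)]
    rfl
  have h2 : |calF T f v - calF T f u - dF f u (v - u)| ≤ ε / T * ‖rep (v - u)‖ * T := by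
    rw [h1]
    refine abs_integral_le_of_ae hT ?_
    filter_upwards [ae_leb_mem T, ae_abs_le_norm (rep (v - u)), rep_sub_ae v u] with t ht h3 h4
    have ht' := Ioo_subset_Icc_self ht
    rw [h4] at h3 ⊢
    refine (hf.abs_primitive_expansion_le ht' fun s hs => hd t ht' s _ ?_).trans
      (mul_le_mul_of_nonneg_left h3 (by positivity))
    exact hs.trans (h3.trans huv)
  refine h2.trans_eq ?_
  field_simp

theorem exists_calF_lipschitz (hf : HypF T f α) (hT : 0 < T) :
    ∃ M, 0 ≤ M ∧ ∀ u v : W1 T, |calF T f v - calF T f u| ≤ M * ‖rep (v - u)‖ := by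
  obtain ⟨M, hM0, hM⟩ := hf.exists_bound
  refine ⟨M * T, by positivity, fun u v => ?_⟩
  have h1 : calF T f v - calF T f u
      = ∫ t, (primitive f t (rep v t) - primitive f t (rep u t)) ∂(leb T) :=
    (integral_sub (hf.integrable_primitive hT v) (hf.integrable_primitive hT u)).symm
  have : |calF T f v - calF T f u| ≤ M * ‖rep (v - u)‖ * T := by
    rw [h1]
    refine abs_integral_le_of_ae hT ?_
    filter_upwards [ae_leb_mem T, ae_abs_le_norm (rep (v - u)), rep_sub_ae v u] with t ht h3 h4
    have ht' := Ioo_subset_Icc_self ht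
    rw [h4] at h3
    exact (hf.abs_primitive_sub_le ht' (hM t ht') _ _).trans (mul_le_mul_of_nonneg_left h3 hM0)
  linarith

theorem hasFDerivAt_calF (hf : HypF T f α) (hT : 0 < T) (u : W1 T) :
    DifferentiableAt ℝ (calF T f) u ∧ ∀ w, fderiv ℝ (calF T f) u w = dF f u w := by
  obtain ⟨M, hM0, hM⟩ := exists_dF_bound hf hT
  let ℓ : W1 T →ₗ[ℝ] ℝ :=
    { toFun := dF f u
      map_add' := dF_add hf hT u
      map_smul' := fun c w => dF_smul u w c }
  let L : W1 T →L[ℝ] ℝ := ℓ.mkContinuous M fun w =>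
    (hM u w).trans (mul_le_mul_of_nonneg_left (norm_rep_le w) hM0)
  have hL : HasFDerivAt (calF T f) L u := by
    rw [hasFDerivAt_iff_isLittleO, Asymptotics.isLittleO_iff]
    intro ε hε
    obtain ⟨δ, hδ, hd⟩ := calF_expansion hf hT hε
    filter_upwards [Metric.closedBall_mem_nhds u hδ] with v hv
    rw [mem_closedBall_iff_norm] at hv
    exact (hd u v ((norm_rep_le _).trans hv)).trans
      (mul_le_mul_of_nonneg_left (norm_rep_le _) hε.le)
  exact ⟨hL.differentiableAt, fun w => by rw [hL.fderiv]; rfl⟩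

/-- Far from the mean-zero functions, `𝓕` is close to `α T` and `𝓕'` is close to zero. -/
theorem calF_at_infinity (hf : HypF T f α) (hT : 0 < T) (a : ℝ) {ε : ℝ} (hε : 0 < ε) :
    ∃ R, ∀ u ∈ K T a, R ≤ |mean u| →
      |calF T f u - α * T| ≤ ε ∧ ∀ w, |dF f u w| ≤ ε * ‖rep w‖ := by
  obtain ⟨R₁, h₁⟩ := hf.lim_f (ε / T) (by positivity)
  obtain ⟨R₂, h₂⟩ := hf.lim_F (ε / T) (by positivity)
  refine ⟨(max R₁ R₂ + a * T) * T, fun u hu hR => ?_⟩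
  have hlarge : ∀ᵐ t ∂(leb T), max R₁ R₂ ≤ |rep u t| := by
    filter_upwards [ae_abs_sub_mean_le hT u] with t ht
    have h3 : ‖der u‖ * T ≤ a * T := mul_le_mul_of_nonneg_right hu hT.le
    have h4 : max R₁ R₂ + a * T ≤ |mean u / T| := by
      rw [abs_div, abs_of_pos hT, le_div_iff₀ hT]; exact hR
    have h5 := abs_sub_abs_le_abs_sub (mean u / T) (rep u t)
    rw [abs_sub_comm] at h5
    linarith
  constructor
  · have h3 : calF T f u - α * T = ∫ t, (primitive f t (rep u t) - α) ∂(leb T) := by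
      rw [integral_sub (hf.integrable_primitive hT u) (integrable_const _), integral_const,
        leb_real_univ hT, smul_eq_mul, mul_comm]
      rfl
    rw [h3]
    refine (abs_integral_le_of_ae hT (C := ε / T) ?_).trans_eq (by field_simp)
    filter_upwards [hlarge, ae_leb_mem T] with t ht htm
    exact (h₂ t (Ioo_subset_Icc_self htm) _ ((le_max_right _ _).trans ht)).le
  · intro w
    refine (abs_integral_le_of_ae hT (C := ε / T * ‖rep w‖) ?_).trans_eq (by field_simp)
    filter_upwards [hlarge, ae_leb_mem T, ae_abs_le_norm (rep w)] with t ht htm h4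
    rw [abs_mul]
    exact mul_le_mul (h₁ t (Ioo_subset_Icc_self htm) _ ((le_max_left _ _).trans ht)).le h4
      (abs_nonneg _) (by positivity)

/-! ### The `L²` inner product -/

/-- The `L²(0, T)` inner product. -/
def ip (u w : W1 T) : ℝ := ∫ t, rep u t * rep w t ∂(leb T)

theorem integrable_ip (u w : W1 T) : Integrable (fun t => rep u t * rep w t) (leb T) :=
  (integrable_Lp (rep u)).mul_bdd (c := ‖rep w‖) (Lp.aestronglyMeasurable _)
    (ae_abs_le_norm (rep w))

theorem ip_comm (u w : W1 T) : ip u w = ip w u := by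
  simp only [ip, mul_comm]

theorem ip_add_right (u v w : W1 T) : ip u (v + w) = ip u v + ip u w := by
  simp only [ip]
  rw [← integral_add (integrable_ip u v) (integrable_ip u w)]
  refine integral_congr_ae ?_
  filter_upwards [rep_add_ae v w] with t ht
  rw [ht]; ring

theorem ip_smul_right (u w : W1 T) (c : ℝ) : ip u (c • w) = c * ip u w := by
  simp only [ip]
  rw [← integral_const_mul]
  refine integral_congr_ae ?_
  filter_upwards [rep_smul_ae c w] with t ht
  rw [ht]; ring

theorem ip_sub_right (u v w : W1 T) : ip u (v - w) = ip u v - ip u w := by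
  have h1 := ip_add_right u (v - w) w
  rw [sub_add_cancel] at h1
  linarith

theorem ip_add_left (u v w : W1 T) : ip (u + v) w = ip u w + ip v w := by
  rw [ip_comm, ip_add_right, ip_comm w, ip_comm w]

theorem ip_sub_left (u v w : W1 T) : ip (u - v) w = ip u w - ip v w := by
  rw [ip_comm, ip_sub_right, ip_comm w, ip_comm w]

theorem ip_smul_left (u w : W1 T) (c : ℝ) : ip (c • u) w = c * ip u w := by
  rw [ip_comm, ip_smul_right, ip_comm]

theorem ip_self_nonneg (u : W1 T) : 0 ≤ ip u u :=
  integral_nonneg fun _ => mul_self_nonneg _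

theorem abs_ip_le (hT : 0 < T) (u w : W1 T) : |ip u w| ≤ T * ‖rep u‖ * ‖rep w‖ := by
  have : |ip u w| ≤ ‖rep u‖ * ‖rep w‖ * T := by
    refine abs_integral_le_of_ae hT ?_
    filter_upwards [ae_abs_le_norm (rep u), ae_abs_le_norm (rep w)] with t h1 h2
    rw [abs_mul]
    exact mul_le_mul h1 h2 (abs_nonneg _) (norm_nonneg _)
  linarith

theorem mean_sq_le (hT : 0 < T) (u : W1 T) : mean u ^ 2 ≤ T * ip u u := by
  obtain ⟨e, he, -⟩ := exists_const_one hT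
  have h1 : ip u e = mean u := by
    refine integral_congr_ae ?_
    filter_upwards [he] with t ht
    rw [ht, mul_one]
  have h2 : ip e e = T := by
    refine Eq.trans (integral_congr_ae ?_) (mean_of_ae_one hT he)
    filter_upwards [he] with t ht
    rw [ht, mul_one]
  have h3 := ip_self_nonneg (T • u - mean u • e)
  rw [ip_sub_left, ip_sub_right, ip_sub_right] at h3
  simp only [ip_smul_left, ip_smul_right] at h3
  rw [ip_comm e u, h1, h2] at h3
  have h4 : 0 ≤ T * (T * ip u u - mean u ^ 2) := by linarith
  linarith [nonneg_of_mul_nonneg_right h4 hT]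

/-- On functions with bounded derivative, smallness in `L²` implies uniform smallness. -/
theorem exists_norm_le_of_ip_le (hT : 0 < T) {L ε : ℝ} (hL : 0 ≤ L) (hε : 0 < ε) :
    ∃ δ > 0, ∀ w : W1 T, ‖der w‖ ≤ L → ip w w ≤ δ → ‖rep w‖ ≤ ε := by
  by_contra! hcon
  choose w hw1 hw2 hw3 using fun n : ℕ => hcon (1 / (n + 1)) (by positivity)
  have hb : ∀ n, ‖rep (w n)‖ ≤ (T + 1) / T + L * T := fun n => by
    refine (norm_rep_le_mean hT _).trans (add_le_add ?_ (mul_le_mul_of_nonneg_right (hw1 n) hT.le))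
    have h1 := mean_sq_le hT (w n)
    have h2 : ip (w n) (w n) ≤ 1 := (hw2 n).trans (by
      rw [div_le_one (by positivity)]
      have : (0 : ℝ) ≤ n := by positivity
      linarith)
    have h3 : |mean (w n)| ≤ T + 1 := by
      refine abs_le_of_sq_le_sq (h1.trans ?_) (by linarith)
      nlinarith
    exact div_le_div_of_nonneg_right h3 hT.le
  obtain ⟨k, z, hk, -, hz⟩ := exists_subseq_tendsto hT hL (u := w) hw1 hb
  rw [tendsto_iff_norm_sub_tendsto_zero] at hz
  have h0 : ip z z ≤ 0 := by
    have hlim : Tendsto (fun n => 1 / ((k n : ℝ) + 1)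
        + 2 * (T * ‖rep z‖ * ‖rep (w (k n)) - rep z‖)) atTop (𝓝 (0 + 2 * (T * ‖rep z‖ * 0))) :=
      (tendsto_one_div_add_atTop_nhds_zero_nat.comp hk.tendsto_atTop).add
        ((hz.const_mul _).const_mul _)
    rw [mul_zero, mul_zero, add_zero] at hlim
    refine ge_of_tendsto' hlim fun n => ?_
    have h1 := hw2 (k n)
    have h2 := ip_self_nonneg (w (k n) - z)
    have h3 := (abs_le.1 (abs_ip_le hT z (w (k n) - z))).1
    simp only [ip_sub_left, ip_sub_right] at h2 h3
    rw [rep_sub] at h3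
    rw [ip_comm (w (k n)) z] at h2
    linarith
  have h1 : ‖rep z‖ ≤ 0 := by
    refine norm_le_of_ae_abs_le le_rfl ?_
    have h2 : ip z z = 0 := le_antisymm h0 (ip_self_nonneg z)
    have h3 := (integral_eq_zero_iff_of_nonneg (fun t => mul_self_nonneg (rep z t))
      (integrable_ip z z)).1 h2
    filter_upwards [h3] with t ht
    have : rep z t = 0 := by simpa using ht
    simp [this]
  have h2 : rep z = 0 := norm_le_zero_iff.1 h1
  rw [h2] at hz
  simp only [sub_zero] at hz
  exact absurd (ge_of_tendsto' hz fun n => (hw3 (k n)).le) (not_le.2 hε)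

/-! ### The direct method -/

/-- Minimization over a subset of `K` closed for uniform convergence, of a functional that is lower
semicontinuous for uniform convergence and bounds the mean on a sublevel set. -/
theorem exists_min (hT : 0 < T) (ha : 0 < a) {S : Set (W1 T)} (hSK : S ⊆ K T a)
    (hcl : ∀ (u : ℕ → W1 T) (w : W1 T), (∀ n, u n ∈ S) → w ∈ K T a →
      Tendsto (fun n => rep (u n)) atTop (𝓝 (rep w)) → w ∈ S)
    {G : W1 T → ℝ}
    (hlsc : ∀ u ∈ S, ∀ ε > 0, ∃ δ > 0, ∀ w ∈ S, ‖rep (w - u)‖ ≤ δ → G u ≤ G w + ε)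
    {v₀ : W1 T} (hv₀ : v₀ ∈ S) {R : ℝ} (hco : ∀ w ∈ S, G w ≤ G v₀ → |mean w| ≤ R) :
    ∃ u ∈ S, ∀ w ∈ S, G u ≤ G w := by
  -- the infimum is taken in `EReal`, where a bound from below is not needed
  set A : Set EReal := (fun w => (G w : EReal)) '' {w | w ∈ S ∧ G w ≤ G v₀} with hA
  have hne : A.Nonempty := ⟨_, v₀, ⟨hv₀, le_rfl⟩, rfl⟩
  obtain ⟨x, -, hx, hxA⟩ := exists_seq_tendsto_sInf hne (OrderBot.bddBelow A)
  choose u hu hux using hxA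
  have hb : ∀ n, ‖rep (u n)‖ ≤ R / T + a * T := fun n =>
    (norm_rep_le_mean hT _).trans (add_le_add
      (div_le_div_of_nonneg_right (hco _ (hu n).1 (hu n).2) hT.le)
      (mul_le_mul_of_nonneg_right (hSK (hu n).1) hT.le))
  obtain ⟨k, z, hk, hzK, hz⟩ := exists_subseq_tendsto hT ha.le (fun n => hSK (hu n).1) hb
  have hzS : z ∈ S := hcl _ z (fun n => (hu (k n)).1) hzK hz
  have main : ∀ y ∈ S, G y ≤ G v₀ → G z ≤ G y := by
    intro y hy hyv
    refine le_of_forall_pos_le_add fun ε hε => ?_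
    obtain ⟨δ, hδ, hd⟩ := hlsc z hzS (ε / 2) (by positivity)
    have h1 : ∀ᶠ n in atTop, ‖rep (u (k n) - z)‖ ≤ δ := by
      filter_upwards [(tendsto_iff_norm_sub_tendsto_zero.1 hz).eventually (ge_mem_nhds hδ)]
        with n hn using hn
    have h2 : sInf A < ((G y + ε / 2 : ℝ) : EReal) :=
      (sInf_le ⟨y, ⟨hy, hyv⟩, rfl⟩ : sInf A ≤ (G y : EReal)).trans_lt
        (EReal.coe_lt_coe_iff.2 (by linarith))
    have h3 := (hx.comp hk.tendsto_atTop).eventually (gt_mem_nhds h2)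
    obtain ⟨n, hn1, hn2⟩ := (h1.and h3).exists
    have h4 := hd _ (hu (k n)).1 hn1
    rw [Function.comp_apply, ← hux (k n), EReal.coe_lt_coe_iff] at hn2
    linarith
  refine ⟨z, hzS, fun y hy => ?_⟩
  rcases le_total (G y) (G v₀) with h1 | h1
  · exact main y hy h1
  · exact (main v₀ hv₀ le_rfl).trans h1

theorem nonneg_of_forall_add_mul {A B : ℝ} (hAB : ∀ s ∈ Ioc (0 : ℝ) 1, 0 ≤ A + s * B) :
    0 ≤ A := by
  have h1 : Tendsto (fun s : ℝ => A + s * B) (𝓝[>] 0) (𝓝 (A + 0 * B)) :=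
    ((Continuous.tendsto (by fun_prop) 0)).mono_left nhdsWithin_le_nhds
  rw [zero_mul, add_zero] at h1
  refine ge_of_tendsto h1 ?_
  filter_upwards [Ioc_mem_nhdsGT one_pos] with s hs using hAB s hs

/-! ### Proximal steps -/

/-- Competitors that do not exceed the base point in the proximal functional stay at a bounded
distance from it: the quadratic term controls the mean of the difference, and `K` the rest. -/
theorem exists_prox_bound (hT : 0 < T) (ha : 0 < a) (hΦ : HypPhi a Φ) (hf : HypF T f α)
    (hh : HypH T h) :
    ∃ R, 0 ≤ R ∧ ∀ v ∈ K T a, ∀ w ∈ K T a,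
      action Φ h w + dF f v (w - v) + 1 / 2 * ip (w - v) (w - v) ≤ action Φ h v →
      ‖rep (w - v)‖ ≤ R := by
  obtain ⟨C, hC0, hC⟩ := exists_action_bound hT ha hΦ hh
  obtain ⟨M, hM0, hM⟩ := exists_dF_bound hf hT
  set B := 4 * C * T + 4 * M * (a * T) * T with hB
  have hB0 : 0 ≤ B := by positivity
  refine ⟨(1 + B + 2 * M) / T + 2 * a * T, by positivity, fun v hv w hw hvw => ?_⟩
  have h1 := norm_rep_le_mean hT (w - v)
  have h2 := mul_le_mul_of_nonneg_right (norm_der_sub_le hw hv) hT.le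
  have h3 := mean_sq_le hT (w - v)
  have h4 := (abs_le.1 (hM v (w - v))).1
  have h5 := (abs_le.1 (hC v hv)).2
  have h6 := (abs_le.1 (hC w hw)).1
  have h7 : ip (w - v) (w - v) ≤ 4 * C + 2 * M * (|mean (w - v)| / T + 2 * a * T) := by
    nlinarith [mul_le_mul_of_nonneg_left h1 hM0, mul_le_mul_of_nonneg_left h2 hM0]
  have h8 : |mean (w - v)| ^ 2 ≤ B + 2 * M * |mean (w - v)| := by
    rw [sq_abs]
    refine h3.trans ((mul_le_mul_of_nonneg_left h7 hT.le).trans_eq ?_)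
    rw [hB]; field_simp; ring
  have h9 : |mean (w - v)| ≤ 1 + B + 2 * M := by
    by_contra! hcon
    nlinarith
  have := div_le_div_of_nonneg_right h9 hT.le
  linarith

/-- `p` is the proximal step from `v`, the minimizer of `w ↦ J(w) + ⟨𝓕'(v), w⟩ + ‖w - v‖²/2` over
`K` for the norm of `L²`, encoded by its variational inequality. -/
def IsProx (a : ℝ) (Φ : ℝ → ℝ) (f : ℝ → ℝ → ℝ) (h : ℝ → ℝ) (v p : W1 T) : Prop :=
  p ∈ K T a ∧ ∀ w ∈ K T a,
    0 ≤ action Φ h w - action Φ h p + dF f v (w - p) + ip (p - v) (w - p)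

theorem exists_prox (hT : 0 < T) (ha : 0 < a) (hΦ : HypPhi a Φ) (hf : HypF T f α)
    (hh : HypH T h) {v : W1 T} (hv : v ∈ K T a) :
    ∃ p, IsProx a Φ f h v p := by
  obtain ⟨R, hR0, hR⟩ := exists_prox_bound hT ha hΦ hf hh
  obtain ⟨M, hM0, hM⟩ := exists_dF_bound hf hT
  set G : W1 T → ℝ := fun w => action Φ h w + dF f v w + 1 / 2 * ip (w - v) (w - v) with hG
  have hex : ∃ p ∈ K T a, ∀ w ∈ K T a, G p ≤ G w := by
    refine exists_min (G := G) hT ha Subset.rfl (fun _ w _ hw _ => hw) ?_ hv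
      (R := R * T + |mean v|) ?_
    · intro u hu ε hε
      obtain ⟨δ, hδ, hd⟩ := action_lsc hT ha hΦ hh hu (ε := ε / 2) (by positivity)
      set D := M + T * ‖rep (u - v)‖ with hD
      have hD0 : 0 ≤ D := by positivity
      refine ⟨min δ (ε / (2 * (D + 1))), by positivity, fun w hw hwu => ?_⟩
      have h1 := hd w hw (hwu.trans (min_le_left _ _))
      have h2 := hwu.trans (min_le_right _ _)
      rw [le_div_iff₀ (by positivity)] at h2
      have h3 := (abs_le.1 (hM v (w - u))).1
      have h4 := (abs_le.1 (abs_ip_le hT (u - v) (w - u))).1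
      have h5 := ip_self_nonneg (w - u)
      have h6 : ip (w - v) (w - v)
          = ip (u - v) (u - v) + 2 * ip (u - v) (w - u) + ip (w - u) (w - u) := by
        rw [show w - v = (u - v) + (w - u) by abel, ip_add_left, ip_add_right, ip_add_right,
          ip_comm (w - u) (u - v)]
        ring
      have h7 : dF f v w = dF f v u + dF f v (w - u) := by rw [dF_sub hf hT]; ring
      simp only [hG]
      rw [h6, h7]
      have h8 : D * ‖rep (w - u)‖ = M * ‖rep (w - u)‖ + T * ‖rep (u - v)‖ * ‖rep (w - u)‖ := by
        rw [hD]; ring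
      nlinarith [norm_nonneg (rep (w - u))]
    · intro w hw hwv
      have h0 : ip (v - v) (v - v) = 0 := by rw [ip_sub_left, sub_self]
      simp only [hG, h0] at hwv
      have h1 := hR v hv w hw (by rw [dF_sub hf hT]; linarith)
      have h2 := abs_mean_le hT (w - v)
      rw [mean_sub] at h2
      have h3 := abs_sub_abs_le_abs_sub (mean w) (mean v)
      have h4 := mul_le_mul_of_nonneg_right h1 hT.le
      linarith
  obtain ⟨p, hp, hmin⟩ := hex
  refine ⟨p, hp, fun w hw => ?_⟩
  refine nonneg_of_forall_add_mul (B := 1 / 2 * ip (w - p) (w - p)) fun s hs => ?_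
  have hs' : s ∈ Icc (0 : ℝ) 1 := Ioc_subset_Icc_self hs
  have h1 := hmin _ (segment_mem_K hp hw hs')
  have h2 := action_segment_le hΦ hh ha hp hw hs'
  simp only [hG] at h1
  rw [dF_add hf hT, dF_smul, show p + s • (w - p) - v = (p - v) + s • (w - p) by abel] at h1
  rw [ip_add_left (p - v), ip_add_right, ip_add_right, ip_smul_right, ip_smul_left,
    ip_smul_left, ip_smul_right, ip_comm (w - p) (p - v)] at h1
  have h3 : 0 ≤ s * (action Φ h w - action Φ h p + dF f v (w - p) + ip (p - v) (w - p)
      + s * (1 / 2 * ip (w - p) (w - p))) := by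
    linarith
  exact nonneg_of_mul_nonneg_right h3 hs.1

namespace IsProx

theorem ip_sub_le (hf : HypF T f α) (hT : 0 < T) {v p : W1 T} (hp : IsProx a Φ f h v p)
    (hv : v ∈ K T a) : ip (p - v) (p - v) ≤ action Φ h v - action Φ h p - dF f v (p - v) := by
  have h1 := hp.2 v hv
  rw [dF_sub hf hT, ip_sub_right] at h1
  rw [dF_sub hf hT, ip_sub_right]
  linarith

theorem exists_norm_bound (hT : 0 < T) (ha : 0 < a) (hΦ : HypPhi a Φ) (hf : HypF T f α)
    (hh : HypH T h) :
    ∃ R, 0 ≤ R ∧ ∀ v ∈ K T a, ∀ p, IsProx a Φ f h v p → ‖rep (p - v)‖ ≤ R := by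
  obtain ⟨R, hR0, hR⟩ := exists_prox_bound hT ha hΦ hf hh
  refine ⟨R, hR0, fun v hv p hp => hR v hv p hp.1 ?_⟩
  linarith [hp.ip_sub_le hf hT hv, ip_self_nonneg (p - v)]

/-- The proximal step depends continuously on the base point, uniformly. -/
theorem continuity (hT : 0 < T) (ha : 0 < a) (hΦ : HypPhi a Φ) (hf : HypF T f α)
    (hh : HypH T h) {ε : ℝ} (hε : 0 < ε) :
    ∃ δ > 0, ∀ v ∈ K T a, ∀ v' ∈ K T a, ∀ p p', IsProx a Φ f h v p → IsProx a Φ f h v' p' →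
      ‖rep (v' - v)‖ ≤ δ → ‖rep (p' - p)‖ ≤ ε := by
  obtain ⟨R, hR0, hR⟩ := exists_norm_bound hT ha hΦ hf hh
  obtain ⟨η, hη, hsmall⟩ := exists_norm_le_of_ip_le hT (L := 2 * a) (by positivity) hε
  obtain ⟨δ, hδ, hd⟩ := dF_continuity hf hT (ε := η / (2 * (2 * R + 1))) (by positivity)
  refine ⟨min δ (min 1 (η / (2 * (2 * R + 1) * T))), by positivity,
    fun v hv v' hv' p p' hp hp' hvv => ?_⟩
  refine hsmall _ (norm_der_sub_le hp'.1 hp.1) ?_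
  have hv1 := hvv.trans (min_le_left _ _)
  have hv2 := hvv.trans ((min_le_right _ _).trans (min_le_left _ _))
  have hv3 := hvv.trans ((min_le_right _ _).trans (min_le_right _ _))
  have hN : ‖rep (p' - p)‖ ≤ 2 * R + 1 := by
    have h1 := hR v hv p hp
    have h2 := hR v' hv' p' hp'
    have h3 : rep (p' - p) = rep (p' - v') + rep (v' - v) - rep (p - v) := by
      rw [← rep_add, ← rep_sub]; congr 1; abel
    rw [h3]
    linarith [norm_sub_le (rep (p' - v') + rep (v' - v)) (rep (p - v)),
      norm_add_le (rep (p' - v')) (rep (v' - v))]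
  have h1 := hp.2 p' hp'.1
  have h2 := hp'.2 p hp.1
  have h3 := (abs_le.1 (hd v' v hv1 (p' - p))).1
  have h4 := (abs_le.1 (abs_ip_le hT (v' - v) (p' - p))).2
  have h5 : ip (p' - p) (p' - p) ≤ ip (v' - v) (p' - p) - (dF f v' (p' - p) - dF f v (p' - p)) := by
    simp only [dF_sub hf hT, ip_sub_left, ip_sub_right] at *
    linarith
  have h6 : η / (2 * (2 * R + 1)) * ‖rep (p' - p)‖ ≤ η / 2 := by
    refine (mul_le_mul_of_nonneg_left hN (by positivity)).trans_eq ?_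
    field_simp
  have h7 : T * ‖rep (v' - v)‖ * ‖rep (p' - p)‖ ≤ η / 2 := by
    refine (mul_le_mul (mul_le_mul_of_nonneg_left hv3 hT.le) hN (norm_nonneg _)
      (by positivity)).trans_eq ?_
    field_simp
  linarith

end IsProx

/-! ### Critical points and almost critical sequences -/

/-- The finite value of the energy `I` on `K`. -/
def realEnergy (Φ : ℝ → ℝ) (f : ℝ → ℝ → ℝ) (h : ℝ → ℝ) (v : W1 T) : ℝ :=
  action Φ h v + calF T f v

/-- The variational inequality of a critical point, restricted to competitors in `K`. -/
def SolvesVI (a : ℝ) (Φ : ℝ → ℝ) (f : ℝ → ℝ → ℝ) (h : ℝ → ℝ) (u : W1 T) : Prop :=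
  u ∈ K T a ∧ ∀ w ∈ K T a, 0 ≤ action Φ h w - action Φ h u + dF f u (w - u)

theorem solvesVI_of_forall_le (hT : 0 < T) (ha : 0 < a) (hΦ : HypPhi a Φ) (hf : HypF T f α)
    (hh : HypH T h) {u : W1 T} (hu : u ∈ K T a)
    (hmin : ∀ w ∈ K T a, realEnergy Φ f h u ≤ realEnergy Φ f h w) : SolvesVI a Φ f h u := by
  refine ⟨hu, fun w hw => ?_⟩
  refine nonneg_of_forall_add_mul (B := ‖rep (w - u)‖) fun ε hε => ?_
  obtain ⟨δ, hδ, hd⟩ := calF_expansion hf hT hε.1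
  set s : ℝ := min 1 (δ / (‖rep (w - u)‖ + 1)) with hs
  have hs0 : 0 < s := by positivity
  have hs' : s ∈ Icc (0 : ℝ) 1 := ⟨hs0.le, min_le_left _ _⟩
  have hsd : s * ‖rep (w - u)‖ ≤ δ := by
    have := min_le_right 1 (δ / (‖rep (w - u)‖ + 1))
    rw [← hs, le_div_iff₀ (by positivity)] at this
    linarith
  have hN : ‖rep (u + s • (w - u) - u)‖ = s * ‖rep (w - u)‖ := by
    rw [add_sub_cancel_left, rep_smul, norm_smul, Real.norm_of_nonneg hs0.le]
  have h1 := (abs_le.1 (hd u (u + s • (w - u)) (hN.trans_le hsd))).2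
  rw [hN, add_sub_cancel_left, dF_smul] at h1
  have h2 := hmin _ (segment_mem_K hu hw hs')
  have h3 := action_segment_le hΦ hh ha hu hw hs'
  simp only [realEnergy] at h2
  have h4 : 0 ≤ s * (action Φ h w - action Φ h u + dF f u (w - u) + ε * ‖rep (w - u)‖) := by
    linarith
  exact nonneg_of_mul_nonneg_right h4 hs0

theorem tendsto_dF (hf : HypF T f α) (hT : 0 < T) {u : ℕ → W1 T} {z : W1 T}
    (hz : Tendsto (fun n => rep (u n)) atTop (𝓝 (rep z))) (v : W1 T) :
    Tendsto (fun n => dF f (u n) (v - u n)) atTop (𝓝 (dF f z (v - z))) := by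
  obtain ⟨M, hM0, hM⟩ := exists_dF_bound hf hT
  have hN : Tendsto (fun n => ‖rep (u n - z)‖) atTop (𝓝 0) :=
    tendsto_iff_norm_sub_tendsto_zero.1 hz
  rw [Metric.tendsto_atTop']
  intro ε hε
  set D := ‖rep (v - z)‖ + 1 with hD
  have hD0 : 0 < D := by positivity
  obtain ⟨δ, hδ, hd⟩ := dF_continuity hf hT (ε := ε / (4 * D)) (by positivity)
  have h1 := hN.eventually (ge_mem_nhds (lt_min hδ (lt_min one_pos
    (by positivity : 0 < ε / (4 * (M + 1))))))
  obtain ⟨n₀, hn₀⟩ := eventually_atTop.1 h1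
  refine ⟨n₀, fun n hn => ?_⟩
  have h2 := hn₀ n hn.le
  have h3 := h2.trans ((min_le_right _ _).trans (min_le_left _ _))
  have h4 := h2.trans ((min_le_right _ _).trans (min_le_right _ _))
  have h5 := hd (u n) z (h2.trans (min_le_left _ _)) (v - u n)
  have h6 := hM z (u n - z)
  have h7 : ‖rep (v - u n)‖ ≤ D := by
    rw [show v - u n = (v - z) - (u n - z) by abel, rep_sub]
    exact (norm_sub_le _ _).trans (by rw [hD]; linarith)
  have h8 : dF f (u n) (v - u n) - dF f z (v - z)
      = (dF f (u n) (v - u n) - dF f z (v - u n)) - dF f z (u n - z) := by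
    simp only [dF_sub hf hT]; ring
  rw [Real.dist_eq, h8]
  have h9 : ε / (4 * D) * ‖rep (v - u n)‖ ≤ ε / 4 := by
    refine (mul_le_mul_of_nonneg_left h7 (by positivity)).trans_eq ?_
    field_simp
  have h10 : M * ‖rep (u n - z)‖ ≤ ε / 4 := by
    rw [le_div_iff₀ (by positivity)] at h4
    nlinarith [norm_nonneg (rep (u n - z))]
  linarith [abs_sub (dF f (u n) (v - u n) - dF f z (v - u n)) (dF f z (u n - z))]

theorem tendsto_calF (hf : HypF T f α) (hT : 0 < T) {u : ℕ → W1 T} {z : W1 T}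
    (hz : Tendsto (fun n => rep (u n)) atTop (𝓝 (rep z))) :
    Tendsto (fun n => calF T f (u n)) atTop (𝓝 (calF T f z)) := by
  obtain ⟨M, hM0, hM⟩ := exists_calF_lipschitz hf hT
  have hN : Tendsto (fun n => ‖rep (u n - z)‖) atTop (𝓝 0) :=
    tendsto_iff_norm_sub_tendsto_zero.1 hz
  rw [tendsto_iff_norm_sub_tendsto_zero]
  refine squeeze_zero (fun _ => norm_nonneg _) (fun n => hM z (u n)) ?_
  simpa using hN.const_mul M

/-- Almost critical sequences in `K`: the variational inequality holds up to an error that tends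
to zero, relative to the uniform distance of the competitor. -/
def AlmostCritical (a : ℝ) (Φ : ℝ → ℝ) (f : ℝ → ℝ → ℝ) (h : ℝ → ℝ) (u : ℕ → W1 T) : Prop :=
  (∀ n, u n ∈ K T a) ∧ ∃ ε : ℕ → ℝ, Tendsto ε atTop (𝓝 0) ∧ (∀ n, 0 ≤ ε n) ∧
    ∀ n, ∀ v ∈ K T a, action Φ h (u n) ≤
      action Φ h v + dF f (u n) (v - u n) + ε n * (1 + ‖rep (v - u n)‖)

theorem AlmostCritical.comp {u : ℕ → W1 T} (hu : AlmostCritical a Φ f h u) {k : ℕ → ℕ}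
    (hk : StrictMono k) : AlmostCritical a Φ f h (u ∘ k) := by
  obtain ⟨h1, ε, h2, h3, h4⟩ := hu
  exact ⟨fun n => h1 _, ε ∘ k, h2.comp hk.tendsto_atTop, fun n => h3 _, fun n => h4 (k n)⟩

/-- Uniform limits of almost critical sequences are critical, and the energies converge. -/
theorem AlmostCritical.limit (hT : 0 < T) (ha : 0 < a) (hΦ : HypPhi a Φ) (hf : HypF T f α)
    (hh : HypH T h) {u : ℕ → W1 T} {z : W1 T} (hu : AlmostCritical a Φ f h u) (hzK : z ∈ K T a)
    (hz : Tendsto (fun n => rep (u n)) atTop (𝓝 (rep z))) :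
    SolvesVI a Φ f h z ∧
      Tendsto (fun n => realEnergy Φ f h (u n)) atTop (𝓝 (realEnergy Φ f h z)) := by
  obtain ⟨huK, ε, hε, -, hle⟩ := hu
  have hbound : ∀ v : W1 T, Tendsto (fun n => action Φ h v + dF f (u n) (v - u n)
      + ε n * (1 + ‖rep (v - u n)‖)) atTop (𝓝 (action Φ h v + dF f z (v - z))) := by
    intro v
    have h1 : Tendsto (fun n => ‖rep (v - u n)‖) atTop (𝓝 ‖rep (v - z)‖) :=
      (hz.const_sub (rep v)).norm
    have h2 := ((tendsto_dF hf hT hz v).const_add (action Φ h v)).add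
      (hε.mul (h1.const_add 1))
    simpa using h2
  have hact : Tendsto (fun n => action Φ h (u n)) atTop (𝓝 (action Φ h z)) := by
    rw [tendsto_order]
    constructor
    · intro b hb
      obtain ⟨δ, hδ, hd⟩ := action_lsc hT ha hΦ hh hzK
        (by linarith : 0 < (action Φ h z - b) / 2)
      have hN : Tendsto (fun n => ‖rep (u n - z)‖) atTop (𝓝 0) :=
        tendsto_iff_norm_sub_tendsto_zero.1 hz
      filter_upwards [hN.eventually (ge_mem_nhds hδ)] with n hn
      linarith [hd _ (huK n) hn]
    · intro b hb
      have h1 := hbound z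
      have h0 : dF f z (z - z) = 0 := by rw [dF_sub hf hT, sub_self]
      rw [h0, add_zero] at h1
      filter_upwards [h1.eventually (gt_mem_nhds hb)] with n hn
      exact (hle n z hzK).trans_lt hn
  refine ⟨⟨hzK, fun v hv => ?_⟩, hact.add (tendsto_calF hf hT hz)⟩
  linarith [le_of_tendsto_of_tendsto' hact (hbound v) fun n => hle n v hv]

/-- Compactness of almost critical sequences. Along a sequence whose means tend to infinity
`𝓕` tends to `α T` and `𝓕'` to zero, so that comparison with the translates of a minimizer `w₀` of `J` over the
mean-zero functions forces the level `J(w₀) + α T`. -/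
theorem AlmostCritical.exists_subseq (hT : 0 < T) (ha : 0 < a) (hΦ : HypPhi a Φ)
    (hf : HypF T f α) (hh : HypH T h) {w₀ : W1 T} (hw₀ : w₀ ∈ K T a) (hw₀m : mean w₀ = 0)
    (hmin : ∀ v ∈ K T a, mean v = 0 → action Φ h w₀ ≤ action Φ h v)
    {u : ℕ → W1 T} (hu : AlmostCritical a Φ f h u)
    (hlev : Tendsto (fun n => realEnergy Φ f h (u n)) atTop (𝓝 c))
    (hc : c ≠ action Φ h w₀ + α * T) :
    ∃ (k : ℕ → ℕ) (z : W1 T), StrictMono k ∧ z ∈ K T a ∧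
      Tendsto (fun n => rep (u (k n))) atTop (𝓝 (rep z)) := by
  obtain ⟨huK, ε, hε, hε0, hle⟩ := hu
  by_cases hb : ∃ R, ∃ᶠ n in atTop, |mean (u n)| ≤ R
  · obtain ⟨R, hR⟩ := hb
    obtain ⟨k, hk, hkR⟩ := extraction_of_frequently_atTop hR
    obtain ⟨l, z, hl, hzK, hz⟩ := exists_subseq_tendsto hT ha.le (u := u ∘ k) (fun n => huK _)
      (R := R / T + a * T) fun n => (norm_rep_le_mean hT _).trans (add_le_add
        (div_le_div_of_nonneg_right (hkR n) hT.le) (mul_le_mul_of_nonneg_right (huK _) hT.le))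
    exact ⟨k ∘ l, z, hk.comp hl, hzK, hz⟩
  · exfalso
    simp only [not_exists, not_frequently, not_le] at hb
    obtain ⟨e, he, hde⟩ := exists_const_one hT
    have hme := mean_of_ae_one hT he
    have hF : Tendsto (fun n => calF T f (u n)) atTop (𝓝 (α * T)) := by
      rw [Metric.tendsto_nhds]
      intro η hη
      obtain ⟨R, hR⟩ := calF_at_infinity hf hT a (ε := η / 2) (by positivity)
      filter_upwards [hb R] with n hn
      rw [Real.dist_eq]
      linarith [(hR _ (huK n) hn.le).1]
    have hJ : Tendsto (fun n => action Φ h (u n)) atTop (𝓝 (c - α * T)) := by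
      refine (hlev.sub hF).congr fun n => ?_
      simp [realEnergy]
    have h1 : action Φ h w₀ ≤ c - α * T :=
      ge_of_tendsto' hJ fun n => action_min_le hT ha hΦ hh hmin (huK n)
    -- the competitor with the same mean as `u n`
    set v : ℕ → W1 T := fun n => w₀ + (mean (u n) / T) • e with hv
    have hv1 : ∀ n, v n ∈ K T a ∧ action Φ h (v n) = action Φ h w₀ := fun n =>
      action_add_const hT hΦ hh ha he hde hw₀ _
    have hv2 : ∀ n, ‖rep (v n - u n)‖ ≤ 2 * a * T := fun n => by
      have h3 : mean (v n - u n) = 0 := by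
        rw [mean_sub, mean_add, mean_smul, hme, hw₀m]
        field_simp; ring
      have h4 := norm_rep_le_mean hT (v n - u n)
      rw [h3] at h4
      have h5 := mul_le_mul_of_nonneg_right (norm_der_sub_le (hv1 n).1 (huK n)) hT.le
      simp only [abs_zero, zero_div, zero_add] at h4
      exact h4.trans h5
    have hdF : Tendsto (fun n => dF f (u n) (v n - u n)) atTop (𝓝 0) := by
      rw [Metric.tendsto_nhds]
      intro η hη
      obtain ⟨R, hR⟩ := calF_at_infinity hf hT a (ε := η / (2 * (2 * a * T))) (by positivity)
      filter_upwards [hb R] with n hn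
      rw [Real.dist_eq, sub_zero]
      have h3 := (hR _ (huK n) hn.le).2 (v n - u n)
      have h4 := mul_le_mul_of_nonneg_left (hv2 n)
        (by positivity : 0 ≤ η / (2 * (2 * a * T)))
      have h5 : η / (2 * (2 * a * T)) * (2 * a * T) = η / 2 := by field_simp
      linarith
    have h2 : c - α * T ≤ action Φ h w₀ := by
      have h3 : Tendsto (fun n => action Φ h w₀ + dF f (u n) (v n - u n)
          + ε n * (1 + 2 * a * T)) atTop (𝓝 (action Φ h w₀ + 0 + 0 * (1 + 2 * a * T))) :=
        (hdF.const_add _).add (hε.mul_const _)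
      rw [zero_mul, add_zero, add_zero] at h3
      refine le_of_tendsto_of_tendsto' hJ h3 fun n => ?_
      have h4 := hle n (v n) (hv1 n).1
      rw [(hv1 n).2] at h4
      exact h4.trans (by
        have := mul_le_mul_of_nonneg_left (hv2 n) (hε0 n)
        linarith)
    exact hc (by linarith)

/-! ### The deformation -/

/-- Away from the critical points at level `c`, a proximal step decreases the linearized energy
by a definite amount. -/
theorem exists_uniform_drop (hT : 0 < T) (ha : 0 < a) (hΦ : HypPhi a Φ)
    (hf : HypF T f α) (hh : HypH T h) {w₀ : W1 T} (hw₀ : w₀ ∈ K T a) (hw₀m : mean w₀ = 0)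
    (hmin : ∀ v ∈ K T a, mean v = 0 → action Φ h w₀ ≤ action Φ h v)
    (hc : c ≠ action Φ h w₀ + α * T)
    (hno : ∀ u : W1 T, SolvesVI a Φ f h u → realEnergy Φ f h u ≠ c) :
    ∃ δ > 0, ∀ v ∈ K T a, ∀ p, IsProx a Φ f h v p → |realEnergy Φ f h v - c| ≤ δ →
      δ ≤ action Φ h v - action Φ h p - dF f v (p - v) := by
  by_contra! hcon
  choose v hv p hp hvc hdrop using fun n : ℕ => hcon (1 / (n + 1)) (by positivity)
  have hlev : Tendsto (fun n => realEnergy Φ f h (v n)) atTop (𝓝 c) := by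
    rw [tendsto_iff_norm_sub_tendsto_zero]
    exact squeeze_zero (fun _ => norm_nonneg _) hvc tendsto_one_div_add_atTop_nhds_zero_nat
  have hN : Tendsto (fun n => ‖rep (p n - v n)‖) atTop (𝓝 0) := by
    rw [Metric.tendsto_nhds]
    intro ε hε
    obtain ⟨δ, hδ, hd⟩ := exists_norm_le_of_ip_le hT (L := 2 * a) (ε := ε / 2) (by positivity)
      (by positivity)
    filter_upwards [tendsto_one_div_add_atTop_nhds_zero_nat.eventually (ge_mem_nhds hδ)]
      with n hn
    rw [Real.dist_eq, sub_zero, abs_of_nonneg (norm_nonneg _)]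
    have := hd (p n - v n) (norm_der_sub_le (hp n).1 (hv n))
      (((hp n).ip_sub_le hf hT (hv n)).trans ((hdrop n).le.trans hn))
    linarith
  have hac : AlmostCritical a Φ f h v := by
    refine ⟨hv, fun n => 1 / ((n : ℝ) + 1) + (T * ‖rep (p n - v n)‖
      + T * ‖rep (p n - v n)‖ * ‖rep (p n - v n)‖), ?_, fun n => by positivity, fun n w hw => ?_⟩
    · have := tendsto_one_div_add_atTop_nhds_zero_nat.add
        ((hN.const_mul T).add ((hN.const_mul T).mul hN))
      simpa using this
    · have h1 := (hp n).2 w hw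
      have h2 := hdrop n
      have h3 := (abs_le.1 (abs_ip_le hT (p n - v n) (w - v n))).2
      have h4 := ip_self_nonneg (p n - v n)
      have h5 : ip (p n - v n) (w - p n)
          = ip (p n - v n) (w - v n) - ip (p n - v n) (p n - v n) := by
        rw [← ip_sub_right]; congr 1; abel
      have h6 : dF f (v n) (w - p n) = dF f (v n) (w - v n) - dF f (v n) (p n - v n) := by
        rw [← dF_sub hf hT]; congr 1; abel
      rw [h5, h6] at h1
      have h7 : 0 ≤ (1 / ((n : ℝ) + 1)
          + T * ‖rep (p n - v n)‖ * ‖rep (p n - v n)‖) * ‖rep (w - v n)‖ := by positivity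
      have h8 : 0 ≤ T * ‖rep (p n - v n)‖ + T * ‖rep (p n - v n)‖ * ‖rep (p n - v n)‖ := by
        positivity
      linarith
  obtain ⟨k, z, hk, hzK, hz⟩ := hac.exists_subseq hT ha hΦ hf hh hw₀ hw₀m hmin hlev hc
  obtain ⟨h1, h2⟩ := (hac.comp hk).limit hT ha hΦ hf hh hzK hz
  exact hno z h1 (tendsto_nhds_unique h2 (hlev.comp hk.tendsto_atTop))

theorem realEnergy_segment_le (hΦ : HypPhi a Φ) (hh : HypH T h) (ha : 0 < a) {v w : W1 T}
    (hv : v ∈ K T a) (hw : w ∈ K T a) {M : ℝ} (hM0 : 0 ≤ M)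
    (hM : ∀ u v : W1 T, |calF T f v - calF T f u| ≤ M * ‖rep (v - u)‖) {E : ℝ}
    (hvE : realEnergy Φ f h v ≤ E) (hwE : realEnergy Φ f h w ≤ E) {s : ℝ}
    (hs : s ∈ Icc (0 : ℝ) 1) :
    realEnergy Φ f h (v + s • (w - v)) ≤ E + 2 * (M * ‖rep (w - v)‖) := by
  have h1 := action_segment_le hΦ hh ha hv hw hs
  have hN : ‖rep (v + s • (w - v) - v)‖ = s * ‖rep (w - v)‖ := by
    rw [add_sub_cancel_left, rep_smul, norm_smul, Real.norm_of_nonneg hs.1]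
  have h2 := (abs_le.1 (hM v (v + s • (w - v)))).2
  have h3 := (abs_le.1 (hM v w)).1
  rw [hN] at h2
  simp only [realEnergy] at *
  have h4 : 0 ≤ M * ‖rep (w - v)‖ := by positivity
  nlinarith [hs.1, hs.2, mul_nonneg hs.1 h4, mul_nonneg (sub_nonneg.2 hs.2) h4,
    mul_nonneg (sub_nonneg.2 hs.2) (sub_nonneg.2 hvE), mul_nonneg hs.1 (sub_nonneg.2 hwE)]

theorem segment_subset_of_forall {F : Set (W1 T)} {v w : W1 T}
    (hF : ∀ s ∈ Icc (0 : ℝ) 1, v + s • (w - v) ∈ F) : segment ℝ v w ⊆ F := by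
  rw [segment_eq_image']
  rintro _ ⟨s, hs, rfl⟩
  exact hF s hs

/-- The mountain pass principle: if `u₁` and `u₂` are joined inside every sublevel set of the energy
above the level `c`, but inside none below it, then `c` is a critical level. -/
theorem exists_critical_of_minimax (hT : 0 < T) (ha : 0 < a) (hΦ : HypPhi a Φ)
    (hf : HypF T f α) (hh : HypH T h) {w₀ : W1 T} (hw₀ : w₀ ∈ K T a) (hw₀m : mean w₀ = 0)
    (hmin : ∀ v ∈ K T a, mean v = 0 → action Φ h w₀ ≤ action Φ h v)
    (hc : c ≠ action Φ h w₀ + α * T) {u₁ u₂ : W1 T}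
    (h₁ : realEnergy Φ f h u₁ < c) (h₂ : realEnergy Φ f h u₂ < c)
    (hup : ∀ c' > c, JoinedIn {v | v ∈ K T a ∧ realEnergy Φ f h v ≤ c'} u₁ u₂)
    (hlow : ∀ c' < c, ¬ JoinedIn {v | v ∈ K T a ∧ realEnergy Φ f h v ≤ c'} u₁ u₂) :
    ∃ u : W1 T, SolvesVI a Φ f h u ∧ realEnergy Φ f h u = c := by
  by_contra! hno
  obtain ⟨δ, hδ, hdrop⟩ := exists_uniform_drop hT ha hΦ hf hh hw₀ hw₀m hmin hc hno
  obtain ⟨R, hR0, hR⟩ := IsProx.exists_norm_bound (f := f) hT ha hΦ hf hh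
  obtain ⟨M, hM0, hM⟩ := exists_calF_lipschitz hf hT
  obtain ⟨η, hη, hexp⟩ := calF_expansion hf hT (ε := δ / (4 * (R + 1))) (by positivity)
  choose! P hP using fun (v : W1 T) (hv : v ∈ K T a) => exists_prox hT ha hΦ hf hh hv
  set g := min (c - realEnergy Φ f h u₁) (c - realEnergy Φ f h u₂) with hg
  have hg0 : 0 < g := lt_min (by linarith) (by linarith)
  set s := min 1 (min (η / (R + 1)) (g / δ)) with hs
  have hs0 : 0 < s := by positivity
  have hs1 : s ≤ 1 := min_le_left _ _
  have hsη : s * (R + 1) ≤ η := by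
    rw [← le_div_iff₀ (by positivity)]
    exact (min_le_right _ _).trans (min_le_left _ _)
  have hsg : s * δ ≤ g := by
    rw [← le_div_iff₀ hδ]
    exact (min_le_right _ _).trans (min_le_right _ _)
  -- the energy along the segment from `v` towards its proximal step
  have hseg : ∀ v ∈ K T a, ∀ σ ∈ Icc 0 s, v + σ • (P v - v) ∈ K T a ∧
      realEnergy Φ f h (v + σ • (P v - v)) ≤ realEnergy Φ f h v
        - σ * (action Φ h v - action Φ h (P v) - dF f v (P v - v)) + σ * (δ / 4) := by
    intro v hv σ hσ
    have hσ' : σ ∈ Icc (0 : ℝ) 1 := ⟨hσ.1, hσ.2.trans hs1⟩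
    refine ⟨segment_mem_K hv (hP v hv).1 hσ', ?_⟩
    have h3 := action_segment_le hΦ hh ha hv (hP v hv).1 hσ'
    have h4 := hR v hv _ (hP v hv)
    have hN : ‖rep (v + σ • (P v - v) - v)‖ = σ * ‖rep (P v - v)‖ := by
      rw [add_sub_cancel_left, rep_smul, norm_smul, Real.norm_of_nonneg hσ.1]
    have h5 : σ * ‖rep (P v - v)‖ ≤ σ * (R + 1) :=
      mul_le_mul_of_nonneg_left (by linarith) hσ.1
    have h6 : σ * (R + 1) ≤ s * (R + 1) := mul_le_mul_of_nonneg_right hσ.2 (by linarith)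
    have h7 := (abs_le.1 (hexp v (v + σ • (P v - v)) (by rw [hN]; linarith))).2
    rw [hN, add_sub_cancel_left, dF_smul] at h7
    have h8 : δ / (4 * (R + 1)) * (σ * ‖rep (P v - v)‖) ≤ σ * (δ / 4) := by
      refine (mul_le_mul_of_nonneg_left h5 (by positivity)).trans_eq ?_
      field_simp
    simp only [realEnergy]
    linarith
  have hdrop0 : ∀ v ∈ K T a, 0 ≤ action Φ h v - action Φ h (P v) - dF f v (P v - v) :=
    fun v hv => (ip_self_nonneg _).trans ((hP v hv).ip_sub_le hf hT hv)
  set c' := c - s * δ / 4 with hc'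
  set F : Set (W1 T) := {v | v ∈ K T a ∧ realEnergy Φ f h v ≤ c'} with hF
  set D : W1 T → W1 T := fun v => v + s • (P v - v) with hD
  have hsδ : 0 < s * δ := by positivity
  -- the end points are joined to their images below the level `c`
  have hend : ∀ v ∈ K T a, realEnergy Φ f h v ≤ c - g → JoinedIn F v (D v) := by
    intro v hv hvg
    refine JoinedIn.of_segment_subset (segment_subset_of_forall fun τ hτ => ?_)
    have h3 : v + τ • (D v - v) = v + (τ * s) • (P v - v) := by
      rw [hD]; simp only [add_sub_cancel_left, smul_smul]
    have hτs : τ * s ∈ Icc 0 s := ⟨mul_nonneg hτ.1 hs0.le, by nlinarith [hτ.2]⟩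
    rw [h3]
    obtain ⟨h4, h5⟩ := hseg v hv (τ * s) hτs
    refine ⟨h4, h5.trans ?_⟩
    have h6 := mul_nonneg hτs.1 (hdrop0 v hv)
    have h7 := mul_le_mul_of_nonneg_right hτs.2 (by positivity : 0 ≤ δ / 4)
    rw [hc']
    linarith
  -- the deformation lowers a path that is close to optimal
  obtain ⟨γ, hγ⟩ := hup (c + s * δ / 4) (by linarith)
  have hlowD : ∀ x, D (γ x) ∈ K T a ∧ realEnergy Φ f h (D (γ x)) ≤ c - s * δ / 2 := by
    intro x
    obtain ⟨hx, hxE⟩ := hγ x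
    obtain ⟨h3, h4⟩ := hseg (γ x) hx s ⟨hs0.le, le_rfl⟩
    refine ⟨h3, h4.trans ?_⟩
    have h7 : s * δ ≤ δ := by nlinarith
    by_cases hclose : c - δ ≤ realEnergy Φ f h (γ x)
    · have h5 := hdrop (γ x) hx _ (hP _ hx) (by rw [abs_le]; constructor <;> linarith)
      have h6 := mul_le_mul_of_nonneg_left h5 hs0.le
      linarith
    · have h6 := mul_nonneg hs0.le (hdrop0 _ hx)
      linarith
  -- nearby points of the deformed path are joined by segments, as the deformation is continuous
  -- for the uniform norm
  have hloc : ∀ x, ∀ᶠ y in 𝓝 x, JoinedIn F (D (γ x)) (D (γ y)) := by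
    intro x
    set ε := s * δ / (16 * (M + 1)) with hε
    have hε0 : 0 < ε := by positivity
    obtain ⟨ρ, hρ, hcont⟩ := IsProx.continuity (f := f) hT ha hΦ hf hh hε0
    have hγc : Tendsto (fun y => ‖γ y - γ x‖) (𝓝 x) (𝓝 0) :=
      tendsto_iff_norm_sub_tendsto_zero.1 (γ.continuous.tendsto x)
    filter_upwards [hγc.eventually (ge_mem_nhds (lt_min hρ hε0))] with y hy
    have hy' := (norm_rep_le _).trans hy
    have h3 := hcont _ (hγ x).1 _ (hγ y).1 _ _ (hP _ (hγ x).1) (hP _ (hγ y).1)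
      (hy'.trans (min_le_left _ _))
    have h4 := hy'.trans (min_le_right _ _)
    have h5 : ‖rep (D (γ y) - D (γ x))‖ ≤ 2 * ε := by
      have h6 : D (γ y) - D (γ x) = (1 - s) • (γ y - γ x) + s • (P (γ y) - P (γ x)) := by
        simp only [hD]; module
      rw [h6, rep_add, rep_smul, rep_smul]
      refine (norm_add_le _ _).trans ?_
      rw [norm_smul, norm_smul, Real.norm_of_nonneg hs0.le, Real.norm_of_nonneg (by linarith)]
      nlinarith [norm_nonneg (rep (γ y - γ x)), norm_nonneg (rep (P (γ y) - P (γ x)))]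
    refine JoinedIn.of_segment_subset (segment_subset_of_forall fun τ hτ => ?_)
    refine ⟨segment_mem_K (hlowD x).1 (hlowD y).1 hτ, ?_⟩
    refine (realEnergy_segment_le hΦ hh ha (hlowD x).1 (hlowD y).1 hM0 hM (hlowD x).2
      (hlowD y).2 hτ).trans ?_
    have h7 : (M + 1) * ε = s * δ / 16 := by rw [hε]; field_simp
    have h8 : M * ‖rep (D (γ y) - D (γ x))‖ ≤ M * (2 * ε) := mul_le_mul_of_nonneg_left h5 hM0
    rw [hc']
    linarith
  have hmid : JoinedIn F (D u₁) (D u₂) := by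
    have h3 := PreconnectedSpace.induction₂'
      (fun x y : unitInterval => JoinedIn F (D (γ x)) (D (γ y)))
      (fun x => (hloc x).mono fun y hy => ⟨hy, hy.symm⟩) ⟨fun _ _ _ h h' => h.trans h'⟩ 0 1
    simpa using h3
  have hu₁ : u₁ ∈ K T a := by have := (hγ 0).1; rwa [γ.source] at this
  have hu₂ : u₂ ∈ K T a := by have := (hγ 1).1; rwa [γ.target] at this
  refine hlow c' (by linarith) ?_
  have hg1 : g ≤ c - realEnergy Φ f h u₁ := min_le_left _ _
  have hg2 : g ≤ c - realEnergy Φ f h u₂ := min_le_right _ _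
  exact ((hend u₁ hu₁ (by linarith)).trans hmid).trans (hend u₂ hu₂ (by linarith)).symm

/-! ### Minimization over the mean-zero functions and over the whole space -/

theorem realEnergy_lsc (hT : 0 < T) (ha : 0 < a) (hΦ : HypPhi a Φ) (hf : HypF T f α)
    (hh : HypH T h) {u : W1 T} (hu : u ∈ K T a) {ε : ℝ} (hε : 0 < ε) :
    ∃ δ > 0, ∀ w ∈ K T a, ‖rep (w - u)‖ ≤ δ →
      realEnergy Φ f h u ≤ realEnergy Φ f h w + ε := by
  obtain ⟨δ, hδ, hd⟩ := action_lsc hT ha hΦ hh hu (ε := ε / 2) (by positivity)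
  obtain ⟨M, hM0, hM⟩ := exists_calF_lipschitz hf hT
  refine ⟨min δ (ε / (2 * (M + 1))), by positivity, fun w hw hwu => ?_⟩
  have h1 := hd w hw (hwu.trans (min_le_left _ _))
  have h2 := hwu.trans (min_le_right _ _)
  rw [le_div_iff₀ (by positivity)] at h2
  have h3 := (abs_le.1 (hM u w)).1
  simp only [realEnergy]
  nlinarith [norm_nonneg (rep (w - u))]

theorem zero_mem_K (ha : 0 < a) : (0 : W1 T) ∈ K T a := by
  change ‖der (0 : W1 T)‖ ≤ a
  rw [show der (0 : W1 T) = 0 from rfl, norm_zero]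
  exact ha.le

theorem mean_zero : mean (0 : W1 T) = 0 := by
  have := mean_smul 0 (0 : W1 T)
  simpa using this

theorem exists_min_meanZero (hT : 0 < T) (ha : 0 < a) {G : W1 T → ℝ}
    (hlsc : ∀ u ∈ K T a, ∀ ε > 0, ∃ δ > 0, ∀ w ∈ K T a, ‖rep (w - u)‖ ≤ δ → G u ≤ G w + ε) :
    ∃ u ∈ K T a, mean u = 0 ∧ ∀ w ∈ K T a, mean w = 0 → G u ≤ G w := by
  obtain ⟨u, ⟨hu, hu0⟩, hmin⟩ := exists_min (S := {v | v ∈ K T a ∧ mean v = 0}) (G := G)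
    (v₀ := 0) (R := 0) hT ha (fun v hv => hv.1)
    (fun u w hu hw hlim => ⟨hw, by
      have h1 : Tendsto (fun n => ‖rep (u n - w)‖ * T) atTop (𝓝 (0 * T)) :=
        (tendsto_iff_norm_sub_tendsto_zero.1 hlim).mul_const T
      rw [zero_mul] at h1
      refine abs_nonpos_iff.1 (ge_of_tendsto' h1 fun n => ?_)
      have h2 := abs_mean_le hT (u n - w)
      rwa [mean_sub, (hu n).2, zero_sub, abs_neg] at h2⟩)
    (fun u hu ε hε => by
      obtain ⟨δ, hδ, hd⟩ := hlsc u hu.1 ε hε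
      exact ⟨δ, hδ, fun w hw => hd w hw.1⟩)
    ⟨zero_mem_K ha, mean_zero⟩ (fun w hw _ => by rw [hw.2, abs_zero])
  exact ⟨u, hu, hu0, fun w hw hw0 => hmin w ⟨hw, hw0⟩⟩

/-- If the minimum of the energy over the mean-zero functions does not exceed the level at
infinity, the energy has a global minimizer. -/
theorem exists_global_min (hT : 0 < T) (ha : 0 < a) (hΦ : HypPhi a Φ) (hf : HypF T f α)
    (hh : HypH T h) {w₀ u₀ : W1 T}
    (hmin : ∀ v ∈ K T a, mean v = 0 → action Φ h w₀ ≤ action Φ h v) (hu₀ : u₀ ∈ K T a)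
    (hle : realEnergy Φ f h u₀ ≤ action Φ h w₀ + α * T) :
    ∃ u ∈ K T a, ∀ w ∈ K T a, realEnergy Φ f h u ≤ realEnergy Φ f h w := by
  by_cases hex : ∃ v ∈ K T a, realEnergy Φ f h v < action Φ h w₀ + α * T
  · obtain ⟨v, hv, hlt⟩ := hex
    obtain ⟨R, hR⟩ := calF_at_infinity hf hT a
      (ε := (action Φ h w₀ + α * T - realEnergy Φ f h v) / 2) (by linarith)
    refine exists_min (R := R) hT ha Subset.rfl (fun _ w _ hw _ => hw)
      (fun u hu ε hε => realEnergy_lsc hT ha hΦ hf hh hu hε) hv fun w hw hwv => ?_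
    by_contra! hcon
    have h1 := (abs_le.1 (hR w hw hcon.le).1).1
    have h2 := action_min_le hT ha hΦ hh hmin hw
    simp only [realEnergy] at *
    linarith
  · push Not at hex
    exact ⟨u₀, hu₀, fun w hw => hle.trans (hex w hw)⟩

/-! ### Extended-real energies -/

theorem J_of_mem {v : W1 T} (hv : v ∈ K T a) : J T a Φ h v = (action Φ h v : EReal) := if_pos hv

theorem J_of_notMem {v : W1 T} (hv : v ∉ K T a) : J T a Φ h v = ⊤ := if_neg hv

theorem energy_of_mem {v : W1 T} (hv : v ∈ K T a) :
    energy T a Φ f h v = (realEnergy Φ f h v : EReal) := by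
  rw [energy, J_of_mem hv, realEnergy, EReal.coe_add]

theorem energy_of_notMem {v : W1 T} (hv : v ∉ K T a) : energy T a Φ f h v = ⊤ := by
  rw [energy, J_of_notMem hv, EReal.top_add_coe]

theorem energy_le_coe_iff {v : W1 T} {b : ℝ} :
    energy T a Φ f h v ≤ (b : EReal) ↔ v ∈ K T a ∧ realEnergy Φ f h v ≤ b := by
  by_cases hv : v ∈ K T a
  · rw [energy_of_mem hv, EReal.coe_le_coe_iff]
    exact ⟨fun hb => ⟨hv, hb⟩, fun hb => hb.2⟩
  · rw [energy_of_notMem hv]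
    simp [hv]

theorem le_energy_of_forall {b : ℝ} {v : W1 T} (hb : v ∈ K T a → b ≤ realEnergy Φ f h v) :
    (b : EReal) ≤ energy T a Φ f h v := by
  by_cases hv : v ∈ K T a
  · rw [energy_of_mem hv, EReal.coe_le_coe_iff]
    exact hb hv
  · rw [energy_of_notMem hv]
    exact le_top

theorem SolvesVI.isCriticalPoint (hf : HypF T f α) (hT : 0 < T) {u : W1 T}
    (hu : SolvesVI a Φ f h u) : IsCriticalPoint T a Φ f h u := by
  obtain ⟨hdiff, hfd⟩ := hasFDerivAt_calF hf hT u
  refine ⟨hu.1, hdiff, fun v => ?_⟩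
  rw [hfd, J_of_mem hu.1]
  by_cases hv : v ∈ K T a
  · rw [J_of_mem hv]
    exact_mod_cast hu.2 v hv
  · rw [J_of_notMem hv, EReal.top_sub_coe, EReal.top_add_coe]
    exact le_top

theorem IsPalaisSmaleSeq.almostCritical (hf : HypF T f α) (hT : 0 < T) (ha : 0 < a)
    {u : ℕ → W1 T} (hu : IsPalaisSmaleSeq T a Φ f h c u) :
    AlmostCritical a Φ f h u ∧
      Tendsto (fun n => realEnergy Φ f h (u n)) atTop (𝓝 c) := by
  obtain ⟨ε, hε, hE, hvi⟩ := hu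
  have huK : ∀ n, u n ∈ K T a := fun n => by
    by_contra hn
    have := hE n
    rw [energy_of_notMem hn] at this
    exact EReal.coe_ne_top _ this.symm
  have hE' : ∀ n, realEnergy Φ f h (u n) = c + ε n := fun n => by
    have := hE n
    rwa [energy_of_mem (huK n), EReal.coe_eq_coe_iff] at this
  refine ⟨⟨huK, fun n => |ε n| * (2 * a + 1), ?_, fun n => by positivity, fun n v hv => ?_⟩, ?_⟩
  · simpa using hε.abs.mul_const (2 * a + 1)
  · have h1 := hvi n v
    rw [(hasFDerivAt_calF hf hT (u n)).2, J_of_mem hv, J_of_mem (huK n)] at h1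
    have h2 : -ε n * ‖v - u n‖ ≤ action Φ h v - action Φ h (u n) + dF f (u n) (v - u n) := by
      exact_mod_cast h1
    have h3 : ‖v - u n‖ ≤ (2 * a + 1) * (1 + ‖rep (v - u n)‖) := by
      rw [norm_W1]
      nlinarith [norm_der_sub_le hv (huK n), norm_nonneg (rep (v - u n))]
    have h4 : ε n * ‖v - u n‖ ≤ |ε n| * ((2 * a + 1) * (1 + ‖rep (v - u n)‖)) :=
      mul_le_mul (le_abs_self _) h3 (norm_nonneg _) (abs_nonneg _)
    linarith
  · simp only [hE']
    simpa using hε.const_add c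

theorem continuous_mean (hT : 0 < T) : Continuous (mean : W1 T → ℝ) := by
  refine continuous_iff_continuousAt.2 fun u => ?_
  rw [ContinuousAt, tendsto_iff_norm_sub_tendsto_zero]
  have h1 : Tendsto (fun v : W1 T => ‖v - u‖ * T) (𝓝 u) (𝓝 (0 * T)) :=
    (tendsto_iff_norm_sub_tendsto_zero.1 tendsto_id).mul_const T
  rw [zero_mul] at h1
  refine squeeze_zero (fun _ => norm_nonneg _) (fun v => ?_) h1
  rw [← mean_sub, Real.norm_eq_abs]
  exact (abs_mean_le hT _).trans (mul_le_mul_of_nonneg_right (norm_rep_le _) hT.le)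

/-- The mountain pass geometry: if the energy on the mean-zero functions stays above the level at
infinity, large constants of either sign, added to a minimizer of `J`, give two valleys. -/
theorem exists_mountainPass (hT : 0 < T) (ha : 0 < a) (hΦ : HypPhi a Φ) (hf : HypF T f α)
    (hh : HypH T h) {w₀ : W1 T} (hw₀ : w₀ ∈ K T a) (hw₀m : mean w₀ = 0)
    (hmin : ∀ v ∈ K T a, mean v = 0 → action Φ h w₀ ≤ action Φ h v) {β : ℝ}
    (hβ : ∀ v ∈ K T a, mean v = 0 → β ≤ realEnergy Φ f h v)
    (hlt : action Φ h w₀ + α * T < β) :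
    ∃ u : W1 T, IsMountainPassPoint T a Φ f h u := by
  obtain ⟨e, he, hde⟩ := exists_const_one hT
  obtain ⟨R, hR⟩ := calF_at_infinity hf hT a
    (ε := (β - (action Φ h w₀ + α * T)) / 2) (by linarith)
  have hvalley : ∀ r : ℝ, |R| ≤ |r| → ∃ u ∈ K T a, mean u = r ∧ realEnergy Φ f h u < β := by
    intro r hr
    obtain ⟨h1, h2⟩ := action_add_const hT hΦ hh ha he hde hw₀ (r / T)
    have h3 : mean (w₀ + (r / T) • e) = r := by
      rw [mean_add, mean_smul, mean_of_ae_one hT he, hw₀m]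
      field_simp; ring
    refine ⟨_, h1, h3, ?_⟩
    have h4 := (abs_le.1 (hR _ h1 (by rw [h3]; exact (le_abs_self R).trans hr)).1).2
    rw [realEnergy, h2]
    linarith
  have hr : |R| ≤ |(|R| + 1)| := by
    exact (lt_add_one _).le.trans (le_abs_self _)
  obtain ⟨u₁, hu₁, hu₁m, hu₁β⟩ := hvalley (-(|R| + 1)) (by rwa [abs_neg])
  obtain ⟨u₂, hu₂, hu₂m, hu₂β⟩ := hvalley (|R| + 1) hr
  have hneg : mean u₁ < 0 := by rw [hu₁m]; linarith [abs_nonneg R]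
  have hpos : 0 < mean u₂ := by rw [hu₂m]; positivity
  -- every path crosses the mean-zero functions
  have hge : (β : EReal) ≤ minimaxLevel T a Φ f h u₁ u₂ := by
    refine le_iInf fun γ => ?_
    have hc : Continuous fun x => mean (γ x) := (continuous_mean hT).comp γ.continuous
    obtain ⟨x, hx⟩ := mem_range_of_exists_le_of_exists_ge hc (c := 0)
      ⟨0, by rw [γ.source]; exact hneg.le⟩ ⟨1, by rw [γ.target]; exact hpos.le⟩
    exact (le_energy_of_forall fun hK => hβ _ hK hx).trans
      (le_iSup (fun x => energy T a Φ f h (γ x)) x)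
  have hjoin : ∀ b : ℝ, JoinedIn {v | v ∈ K T a ∧ realEnergy Φ f h v ≤ b} u₁ u₂ →
      minimaxLevel T a Φ f h u₁ u₂ ≤ (b : EReal) := by
    rintro b ⟨γ, hγ⟩
    exact (iInf_le _ γ).trans (iSup_le fun x => energy_le_coe_iff.2 (hγ x))
  obtain ⟨M, hM0, hM⟩ := exists_calF_lipschitz hf hT
  have hle := hjoin (β + 2 * (M * ‖rep (u₂ - u₁)‖)) (JoinedIn.of_segment_subset
    (segment_subset_of_forall fun s hs => ⟨segment_mem_K hu₁ hu₂ hs,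
      realEnergy_segment_le hΦ hh ha hu₁ hu₂ hM0 hM hu₁β.le hu₂β.le hs⟩))
  obtain ⟨c, hc⟩ : ∃ c : ℝ, (c : EReal) = minimaxLevel T a Φ f h u₁ u₂ :=
    ⟨_, EReal.coe_toReal (hle.trans_lt (EReal.coe_lt_top _)).ne
      ((EReal.bot_lt_coe _).trans_le hge).ne'⟩
  have hβc : β ≤ c := by rwa [← hc, EReal.coe_le_coe_iff] at hge
  obtain ⟨u, hu, huc⟩ := exists_critical_of_minimax hT ha hΦ hf hh hw₀ hw₀m hmin (c := c)
    (by linarith : action Φ h w₀ + α * T < c).ne' (hu₁β.trans_le hβc) (hu₂β.trans_le hβc)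
    (fun c' hc' => by
      have h1 : minimaxLevel T a Φ f h u₁ u₂ < (c' : EReal) := by
        rw [← hc]; exact EReal.coe_lt_coe_iff.2 hc'
      obtain ⟨γ, hγ⟩ := iInf_lt_iff.1 h1
      exact ⟨γ, fun x => energy_le_coe_iff.1
        ((le_iSup (fun x => energy T a Φ f h (γ x)) x).trans hγ.le)⟩)
    (fun c' hc' hj => by
      have h1 := hjoin c' hj
      rw [← hc, EReal.coe_le_coe_iff] at h1
      linarith)
  have hinf : (β : EReal) ≤ ⨅ v ∈ meanZero T, energy T a Φ f h v :=
    le_iInf₂ fun v hv => le_energy_of_forall fun hK => hβ v hK hv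
  refine ⟨u, hu.isCriticalPoint hf hT, u₁, u₂, hneg, hpos, ?_, ?_, ?_⟩
  · rw [energy_of_mem hu₁]
    exact (EReal.coe_lt_coe_iff.2 hu₁β).trans_le hinf
  · rw [energy_of_mem hu₂]
    exact (EReal.coe_lt_coe_iff.2 hu₂β).trans_le hinf
  · rw [energy_of_mem hu.1, huc, hc]

end StrongResonance

end

open StrongResonance in
theorem theorem2p3 (T a α : ℝ) (hT : 0 < T) (ha : 0 < a)
    (Φ : ℝ → ℝ) (f : ℝ → ℝ → ℝ) (h : ℝ → ℝ)
    (hΦ : HypPhi a Φ) (hf : HypF T f α) (hh : HypH T h) :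
    (∃ u : W1 T, IsCriticalPoint T a Φ f h u) ∧
    ∃ m β : ℝ,
      IsLeast (J T a Φ h '' meanZero T) (m : EReal) ∧
      IsLeast (energy T a Φ f h '' meanZero T) (β : EReal) ∧
      (∀ c : ℝ, c ≠ m + α * T → PalaisSmaleCondition T a Φ f h c) ∧
      (β ≤ m + α * T → ∃ u : W1 T, IsCriticalPoint T a Φ f h u ∧
        ∀ v : W1 T, energy T a Φ f h u ≤ energy T a Φ f h v) ∧
      (m + α * T < β → ∃ u : W1 T, IsMountainPassPoint T a Φ f h u) := by
  obtain ⟨w₀, hw₀, hw₀m, hmin⟩ := exists_min_meanZero hT ha (G := action Φ h)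
    fun u hu ε hε => action_lsc hT ha hΦ hh hu hε
  obtain ⟨u₀, hu₀, hu₀m, hβ⟩ := exists_min_meanZero hT ha (G := realEnergy Φ f h)
    fun u hu ε hε => realEnergy_lsc hT ha hΦ hf hh hu hε
  have hglobal : realEnergy Φ f h u₀ ≤ action Φ h w₀ + α * T →
      ∃ u : W1 T, IsCriticalPoint T a Φ f h u ∧
        ∀ v : W1 T, energy T a Φ f h u ≤ energy T a Φ f h v := fun hle => by
    obtain ⟨u, hu, humin⟩ := exists_global_min hT ha hΦ hf hh hmin hu₀ hle
    refine ⟨u, (solvesVI_of_forall_le hT ha hΦ hf hh hu humin).isCriticalPoint hf hT,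
      fun v => ?_⟩
    rw [energy_of_mem hu]
    exact le_energy_of_forall (humin v)
  have hpass : action Φ h w₀ + α * T < realEnergy Φ f h u₀ →
      ∃ u : W1 T, IsMountainPassPoint T a Φ f h u := fun hlt =>
    exists_mountainPass hT ha hΦ hf hh hw₀ hw₀m hmin hβ hlt
  refine ⟨?_, action Φ h w₀, realEnergy Φ f h u₀, ⟨⟨w₀, hw₀m, J_of_mem hw₀⟩, ?_⟩,
    ⟨⟨u₀, hu₀m, energy_of_mem hu₀⟩, ?_⟩, ?_, hglobal, hpass⟩
  · rcases le_or_gt (realEnergy Φ f h u₀) (action Φ h w₀ + α * T) with hle | hlt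
    · obtain ⟨u, hu, -⟩ := hglobal hle
      exact ⟨u, hu⟩
    · obtain ⟨u, hu, -⟩ := hpass hlt
      exact ⟨u, hu⟩
  · rintro _ ⟨v, hv, rfl⟩
    by_cases hK : v ∈ K T a
    · rw [J_of_mem hK, EReal.coe_le_coe_iff]
      exact hmin v hK hv
    · rw [J_of_notMem hK]
      exact le_top
  · rintro _ ⟨v, hv, rfl⟩
    exact le_energy_of_forall fun hK => hβ v hK hv
  · intro c hc u hu
    obtain ⟨hac, hlev⟩ := hu.almostCritical hf hT ha
    obtain ⟨k, z, hk, -, hz⟩ := hac.exists_subseq hT ha hΦ hf hh hw₀ hw₀m hmin hlev hc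
    exact ⟨k, rep z, hk, hz⟩
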